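/- Let $n\ge 0$ be an integer, $\alpha>-1$ and $0<a\le A$, and let $S$ be the space of real symmetric $n\times n$ matrices. Let $F:(\mathbb R^n\setminus\{0\})\times S\to\mathbb R$ be continuous and such that (H1) $F(tp,\mu X)=|t|^{\alpha}\mu F(p,X)$ for all $p\ne0$, $X\in S$, $t\in\mathbb R\setminus\{0\}$, $\mu>0$, and $F(p,X)\le F(p,Y)$ whenever $p\neq 0$ and $X\le Y$; (H2) $a|p|^{\alpha}\,\mathrm{tr}\,P\le F(p,M+P)-F(p,M)\le A|p|^{\alpha}\,\mathrm{tr}\,P$ for all $p\ne 0$, $M\in S$ and all positive semidefinite $P\in S$. Let $\Omega\subset\mathbb R^n$ be a bounded open set with $C^2$ boundary, let $f:\Omega\to\mathbb R$ be bounded, and let $u:\overline\Omega\to[0,\infty)$ be a continuous viscosity solution of $$F(\nabla u,D^2u)=f\ \text{ in }\Omega,\qquad u=0\ \text{ on }\partial\Omega .$$ Then $u$ is locally Lipschitz continuous in $\Omega$. Here a bounded function $u$ on $\overline\Omega$, with lower and upper semicontinuous envelopes $u_\star$ and $u^\star$, is a viscosity solution of $F(\nabla u,D^2u)=f$ in $\Omega$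 if for every $x_0\in\Omega$: (i) if $u$ is constant in a ball centred at $x_0$ and contained in $\Omega$, then $f(x_0)=0$; (ii) $F(\nabla\varphi(x_0),D^2\varphi(x_0))\le f(x_0)$ for every $\varphi\in C^2(\Omega)$ such that $u_\star-\varphi$ has a local minimum at $x_0$ and $\nabla\varphi(x_0)\neq0$; (iii) $F(\nabla\varphi(x_0),D^2\varphi(x_0))\ge f(x_0)$ for every $\varphi\in C^2(\Omega)$ such that $u^\star-\varphi$ has a strict local maximum at $x_0$ and $\nabla\varphi(x_0)\ne0$. (For continuous $u$, $u_\star=u^\star=u$.) -/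

import Mathlib

open Set Filter Topology

/-- Euclidean space `ℝ^n`. -/
abbrev EucSp (n : ℕ) : Type := EuclideanSpace ℝ (Fin n)

/-- A second-order operator `F(p, X)`. Only its values at `p ≠ 0` and symmetric `X` are ever used. -/
abbrev SecondOrderOp (n : ℕ) : Type := EucSp n → Matrix (Fin n) (Fin n) ℝ → ℝ

/-- Homogeneity `F(tp, μX) = |t|^α μ F(p, X)` and degenerate ellipticity. -/
def HomogeneousElliptic {n : ℕ} (α : ℝ) (F : SecondOrderOp n) : Prop :=
  (∀ (p : EucSp n) (X : Matrix (Fin n) (Fin n) ℝ) (t μ : ℝ), p ≠ 0 → X.IsSymm → t ≠ 0 → 0 < μ →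
      F (t • p) (μ • X) = |t| ^ α * μ * F p X) ∧
  (∀ (p : EucSp n) (X Y : Matrix (Fin n) (Fin n) ℝ), p ≠ 0 → X.IsSymm → Y.IsSymm →
      (Y - X).PosSemidef → F p X ≤ F p Y)

/-- `a |p|^α tr P ≤ F(p, M + P) - F(p, M) ≤ A |p|^α tr P` for `P ≥ 0`. -/
def WeightedUniformlyElliptic {n : ℕ} (α a A : ℝ) (F : SecondOrderOp n) : Prop :=
  ∀ (p : EucSp n) (M P : Matrix (Fin n) (Fin n) ℝ), p ≠ 0 → M.IsSymm → P.PosSemidef →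
    a * ‖p‖ ^ α * P.trace ≤ F p (M + P) - F p M ∧
      F p (M + P) - F p M ≤ A * ‖p‖ ^ α * P.trace

/-- `F` is continuous on `(ℝ^n ∖ {0}) × S`, where `S` is the set of symmetric matrices. -/
def ContinuousOffZero {n : ℕ} (F : SecondOrderOp n) : Prop :=
  ContinuousOn (fun q : EucSp n × Matrix (Fin n) (Fin n) ℝ => F q.1 q.2)
    {q | q.1 ≠ 0 ∧ q.2.IsSymm}

/-- The Hessian matrix `D²φ(x)`. -/
noncomputable def hessianMatrix {n : ℕ} (φ : EucSp n → ℝ) (x : EucSp n) :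
    Matrix (Fin n) (Fin n) ℝ :=
  Matrix.of fun i j =>
    fderiv ℝ (fderiv ℝ φ) x (EuclideanSpace.single i 1) (EuclideanSpace.single j 1)

/-- The upper semicontinuous envelope on the closure of `Ω`
(the filter contains the point itself). -/
noncomputable def upperEnvelope {n : ℕ} (Ω : Set (EucSp n)) (u : EucSp n → ℝ) (x : EucSp n) : ℝ :=
  limsup u (𝓝[closure Ω] x)

/-- The lower semicontinuous envelope on the closure of `Ω`. -/
noncomputable def lowerEnvelope {n : ℕ} (Ω : Set (EucSp n)) (u : EucSp n → ℝ) (x : EucSp n) : ℝ :=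
  liminf u (𝓝[closure Ω] x)

/-- `u` is bounded on the closure of `Ω`. -/
def BoundedOnClosure {n : ℕ} (Ω : Set (EucSp n)) (u : EucSp n → ℝ) : Prop :=
  ∃ C : ℝ, ∀ x ∈ closure Ω, |u x| ≤ C

/-- Viscosity super-solution of `F(∇v, D²v) = g(x, v)` in `Ω`. If `v` is equal to a constant `c`
near `x₀`, the requirement is `0 ≤ g(x₀, c)`; otherwise it is the inequality for test functions
touching from below at `x₀` with non-zero gradient. Where `v` is locally constant there are no such
test functions, so that both requirements can be imposed at every point. -/
def IsViscositySuperSol {n : ℕ} (F : SecondOrderOp n) (Ω : Set (EucSp n)) (g : EucSp n → ℝ → ℝ)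
    (v : EucSp n → ℝ) : Prop :=
  BoundedOnClosure Ω v ∧
  ∀ x₀ ∈ Ω,
    (∀ (δ c : ℝ), 0 < δ → Metric.ball x₀ δ ⊆ Ω → (∀ x ∈ Metric.ball x₀ δ, v x = c) →
      0 ≤ g x₀ c) ∧
    (∀ φ : EucSp n → ℝ, ContDiffOn ℝ 2 φ Ω →
      IsLocalMin (fun x => lowerEnvelope Ω v x - φ x) x₀ → gradient φ x₀ ≠ 0 →
      F (gradient φ x₀) (hessianMatrix φ x₀) ≤ g x₀ (lowerEnvelope Ω v x₀))

/-- Viscosity sub-solution of `F(∇u, D²u) = g(x, u)` in `Ω`; the test functions touch from above,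
strictly. -/
def IsViscositySubSol {n : ℕ} (F : SecondOrderOp n) (Ω : Set (EucSp n)) (g : EucSp n → ℝ → ℝ)
    (u : EucSp n → ℝ) : Prop :=
  BoundedOnClosure Ω u ∧
  ∀ x₀ ∈ Ω,
    (∀ (δ c : ℝ), 0 < δ → Metric.ball x₀ δ ⊆ Ω → (∀ x ∈ Metric.ball x₀ δ, u x = c) →
      g x₀ c ≤ 0) ∧
    (∀ φ : EucSp n → ℝ, ContDiffOn ℝ 2 φ Ω →
      (∀ᶠ x in 𝓝[≠] x₀, upperEnvelope Ω u x - φ x < upperEnvelope Ω u x₀ - φ x₀) →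
      gradient φ x₀ ≠ 0 →
      g x₀ (upperEnvelope Ω u x₀) ≤ F (gradient φ x₀) (hessianMatrix φ x₀))

/-- Viscosity solution of `F(∇u, D²u) = g(x, u)` in `Ω`. -/
def IsViscositySol {n : ℕ} (F : SecondOrderOp n) (Ω : Set (EucSp n)) (g : EucSp n → ℝ → ℝ)
    (u : EucSp n → ℝ) : Prop :=
  IsViscositySubSol F Ω g u ∧ IsViscositySuperSol F Ω g u

/-- A bounded open set with `C²` boundary: near each boundary point it is a strict sublevel set of
a `C²` function with non-zero gradient. -/
def IsBoundedC2Domain {n : ℕ} (Ω : Set (EucSp n)) : Prop :=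
  IsOpen Ω ∧ Bornology.IsBounded Ω ∧
  ∀ z ∈ frontier Ω, ∃ ρ : EucSp n → ℝ,
    ContDiffAt ℝ 2 ρ z ∧ gradient ρ z ≠ 0 ∧ ∀ᶠ x in 𝓝 z, (x ∈ Ω ↔ ρ x < 0)

/-! The proof is the Ishii–Lions method. Compare `u x - u y` with the concave modulus `ψ(z) = L (‖z‖
- κ ‖z‖²)`, where κ depends only on the size of Ω. If the comparison fails, `u x - u y - ψ (x - y)`
has a positive maximum. It cannot occur at the boundary: a barrier built on uniform exterior balls
gives `u x ≤ L₀ ‖x - z‖` for boundary points z (`boundary_linear_bound`), and L is taken large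
compared with L₀.

At an interior maximum the two jets have gradients of size about L, nearly opposite, and Hessians
with `T₁ + T₂ ≤ 0`. Concavity of ψ adds `⟪(T₁ + T₂) e, e⟫ ≤ -8 L κ` in one unit direction. Weighted
ellipticity turns this into a gap of order `a κ L^(1 + α)` between the values of F at the two
points, whereas the equation allows only a gap of order `sup |f|`. Since `1 + α > 0`, a large L is
impossible (`sub_le_concaveCone`).

The jets come from `exists_superjets_of_doubling`, a substitute for the Crandall–Ishii lemma without
Aleksandrov's theorem. Lasry–Lions regularization replaces u and -u by `C^{1,1}` functions, whose
gradients are Lipschitz and so differentiable almost everywhere. Perturbing the doubled function by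
small linear terms gives maximum points on which a Lipschitz gradient map is onto a ball. A
Lipschitz map sends null sets to null sets, so some maximum point is a point of twice
differentiability. The Hessian there is below the regularization scale, so the regularization
touches u directly and its jet passes to u. -/

open scoped RealInnerProductSpace

/-! ### Quadratic forms, jets and paraboloids -/

/-- The matrix of the quadratic form `⟪T h, h⟫` in the standard basis. -/
noncomputable def quadMatrix {n : ℕ} (T : EucSp n →L[ℝ] EucSp n) : Matrix (Fin n) (Fin n) ℝ :=
  Matrix.of fun i j => ⟪T (EuclideanSpace.single i 1), EuclideanSpace.single j (1 : ℝ)⟫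

/-- `(p, T)` is a second-order superjet of `u` at `ξ`. -/
def IsSuperjet {E : Type*} [NormedAddCommGroup E] [InnerProductSpace ℝ E]
    (u : E → ℝ) (ξ p : E) (T : E →L[ℝ] E) : Prop :=
  ∀ ε > 0, ∀ᶠ x in 𝓝 ξ,
    u x ≤ u ξ + ⟪p, x - ξ⟫ + ⟪T (x - ξ), x - ξ⟫ / 2 + ε * ‖x - ξ‖ ^ 2

theorem quadMatrix_add {n : ℕ} (T S : EucSp n →L[ℝ] EucSp n) :
    quadMatrix (T + S) = quadMatrix T + quadMatrix S := by
  ext i j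
  simp [quadMatrix, inner_add_left]

theorem quadMatrix_smul_id {n : ℕ} (c : ℝ) :
    quadMatrix (c • ContinuousLinearMap.id ℝ (EucSp n)) = c • (1 : Matrix (Fin n) (Fin n) ℝ) := by
  ext i j
  simp [quadMatrix, inner_smul_left, Matrix.one_apply, EuclideanSpace.inner_single_left]

theorem quadMatrix_isSymm {n : ℕ} {T : EucSp n →L[ℝ] EucSp n}
    (hT : ∀ a b, ⟪T a, b⟫ = ⟪a, T b⟫) : (quadMatrix T).IsSymm := by
  ext i j
  simp only [quadMatrix, Matrix.transpose_apply, Matrix.of_apply]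
  rw [hT, real_inner_comm]

theorem inner_eq_sum_quadMatrix {n : ℕ} (T : EucSp n →L[ℝ] EucSp n) (x y : EucSp n) :
    ⟪T x, y⟫ = ∑ i, ∑ j, x i * y j * quadMatrix T i j := by
  have hx : x = ∑ i, x i • EuclideanSpace.single i (1 : ℝ) := by
    ext j; simp [Finset.sum_apply, Pi.single_apply]
  have hy : y = ∑ i, y i • EuclideanSpace.single i (1 : ℝ) := by
    ext j; simp [Finset.sum_apply, Pi.single_apply]
  conv_lhs => rw [hx, hy]
  simp only [map_sum, map_smul, sum_inner, inner_sum, inner_smul_left, inner_smul_right,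
    quadMatrix, Matrix.of_apply, Finset.mul_sum]
  rw [Finset.sum_comm]
  refine Finset.sum_congr rfl fun i _ => Finset.sum_congr rfl fun j _ => ?_
  simp only [conj_trivial]; ring

theorem quadMatrix_posSemidef {n : ℕ} {T : EucSp n →L[ℝ] EucSp n}
    (hT : ∀ a b, ⟪T a, b⟫ = ⟪a, T b⟫) (h0 : ∀ a, 0 ≤ ⟪T a, a⟫) : (quadMatrix T).PosSemidef := by
  refine Matrix.PosSemidef.of_dotProduct_mulVec_nonneg ?_ fun x => ?_
  · exact (Matrix.conjTranspose_eq_transpose_of_trivial _).trans (quadMatrix_isSymm hT)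
  · have := h0 (WithLp.toLp 2 x)
    rw [inner_eq_sum_quadMatrix] at this
    refine this.trans_eq ?_
    simp only [dotProduct, Matrix.mulVec, Finset.mul_sum, Pi.star_apply, star_trivial]
    refine Finset.sum_congr rfl fun i _ => Finset.sum_congr rfl fun j _ => ?_
    ring

open scoped MatrixOrder Matrix.Norms.L2Operator in
/-- The Rayleigh quotient of a nonnegative form is at most its trace. -/
theorem inner_le_trace_quadMatrix {n : ℕ} {T : EucSp n →L[ℝ] EucSp n}
    (hT : ∀ a b, ⟪T a, b⟫ = ⟪a, T b⟫) (h0 : ∀ a, 0 ≤ ⟪T a, a⟫) (e : EucSp n) :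
    ⟪T e, e⟫ ≤ (quadMatrix T).trace * ‖e‖ ^ 2 := by
  -- Write the matrix as `Bᵀ B`: the form is `‖B e‖²`, the trace is the sum of the squared entries
  -- of B, and Cauchy–Schwarz on each row concludes.
  obtain ⟨B, hB⟩ := CStarAlgebra.nonneg_iff_eq_star_mul_self.1 (quadMatrix_posSemidef hT h0).nonneg
  rw [Matrix.star_eq_conjTranspose] at hB
  have h1 : ⟪T e, e⟫ = ∑ k, (∑ i, B k i * e i) ^ 2 := by
    rw [inner_eq_sum_quadMatrix, hB]
    simp only [Matrix.mul_apply, Matrix.conjTranspose_apply, star_trivial, sq, Finset.sum_mul_sum]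
    conv_rhs => rw [Finset.sum_comm]
    refine Finset.sum_congr rfl fun i _ => ?_
    conv_rhs => rw [Finset.sum_comm]
    refine Finset.sum_congr rfl fun j _ => ?_
    rw [Finset.mul_sum]
    refine Finset.sum_congr rfl fun k _ => ?_
    ring
  have h2 : (quadMatrix T).trace = ∑ k, ∑ i, B k i ^ 2 := by
    rw [hB, Finset.sum_comm]
    simp [Matrix.trace, Matrix.mul_apply, sq]
  rw [h1, h2, Finset.sum_mul, EuclideanSpace.real_norm_sq_eq]
  exact Finset.sum_le_sum fun k _ => Finset.sum_mul_sq_le_sq_mul_sq _ _ _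

/-- The paraboloid with gradient `p` and Hessian `T` at `ξ`. -/
noncomputable def paraboloid {E : Type*} [NormedAddCommGroup E] [InnerProductSpace ℝ E]
    (ξ p : E) (T : E →L[ℝ] E) (x : E) : ℝ :=
  ⟪p, x - ξ⟫ + ⟪T (x - ξ), x - ξ⟫ / 2

section paraboloid
variable {n : ℕ} (ξ p : EucSp n) (T : EucSp n →L[ℝ] EucSp n)

theorem contDiff_paraboloid : ContDiff ℝ 2 (paraboloid ξ p T) := by
  unfold paraboloid
  have h : ContDiff ℝ 2 fun x => x - ξ := contDiff_id.sub contDiff_const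
  exact (contDiff_const.inner ℝ h).add (((T.contDiff.comp h).inner ℝ h).div_const 2)

theorem hasFDerivAt_paraboloid (hT : ∀ a b, ⟪T a, b⟫ = ⟪a, T b⟫) (x : EucSp n) :
    HasFDerivAt (paraboloid ξ p T) (innerSL ℝ (p + T (x - ξ))) x := by
  have h1 : HasFDerivAt (fun x => x - ξ) (ContinuousLinearMap.id ℝ (EucSp n)) x :=
    (hasFDerivAt_id x).sub_const ξ
  have h2 : HasFDerivAt (fun x => T (x - ξ)) (T.comp (ContinuousLinearMap.id ℝ (EucSp n))) x :=
    T.hasFDerivAt.comp x h1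
  have h3 := ((hasFDerivAt_const p x).inner ℝ h1).add ((h2.inner ℝ h1).mul_const (1 / 2 : ℝ))
  refine HasFDerivAt.congr_of_eventuallyEq (h3.congr_fderiv ?_)
    (Eventually.of_forall fun x => by simp [paraboloid, div_eq_mul_inv])
  ext v
  simp [fderivInnerCLM_apply]
  rw [hT v, real_inner_comm (T (x - ξ)) v, map_sub, inner_sub_left]
  ring

theorem gradient_paraboloid (hT : ∀ a b, ⟪T a, b⟫ = ⟪a, T b⟫) :
    gradient (paraboloid ξ p T) ξ = p := by
  refine HasGradientAt.gradient ?_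
  rw [hasGradientAt_iff_hasFDerivAt]
  refine (hasFDerivAt_paraboloid ξ p T hT ξ).congr_fderiv ?_
  ext v
  simp

theorem hessianMatrix_paraboloid (hT : ∀ a b, ⟪T a, b⟫ = ⟪a, T b⟫) (x : EucSp n) :
    hessianMatrix (paraboloid ξ p T) x = quadMatrix T := by
  have h1 : fderiv ℝ (paraboloid ξ p T) = fun x => innerSL ℝ (p + T (x - ξ)) :=
    funext fun x => (hasFDerivAt_paraboloid ξ p T hT x).fderiv
  have h2 : HasFDerivAt (fun x => innerSL ℝ (p + T (x - ξ))) ((innerSL ℝ).comp T) x := by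
    refine (innerSL ℝ).hasFDerivAt.comp x ?_
    have := T.hasFDerivAt.comp x ((hasFDerivAt_id x).sub_const ξ)
    exact this.const_add p
  ext i j
  simp only [hessianMatrix, quadMatrix, Matrix.of_apply]
  rw [h1, h2.fderiv]
  rfl

end paraboloid

/-! ### Viscosity inequalities on second-order jets -/

theorem envelopes_eq {n : ℕ} {Ω : Set (EucSp n)} {u : EucSp n → ℝ}
    (hu : ContinuousOn u (closure Ω)) {x : EucSp n} (hx : x ∈ Ω) :
    upperEnvelope Ω u x = u x ∧ lowerEnvelope Ω u x = u x := by
  have h := hu x (subset_closure hx)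
  have : (𝓝[closure Ω] x).NeBot := mem_closure_iff_nhdsWithin_neBot.1 (by simpa using subset_closure hx)
  exact ⟨h.limsup_eq, h.liminf_eq⟩

section viscosity
variable {n : ℕ} {α a A : ℝ} {F : SecondOrderOp n} {Ω : Set (EucSp n)} {f u : EucSp n → ℝ}

theorem WeightedUniformlyElliptic.add_smul_one_le (hF₂ : WeightedUniformlyElliptic α a A F)
    {p : EucSp n} (hp : p ≠ 0) {M : Matrix (Fin n) (Fin n) ℝ} (hM : M.IsSymm) {ε : ℝ}
    (hε : 0 ≤ ε) : F p (M + ε • (1 : Matrix (Fin n) (Fin n) ℝ)) ≤ F p M + ε * (A * ‖p‖ ^ α * n) := by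
  have := (hF₂ p M (ε • 1) hp hM (Matrix.PosSemidef.one.smul hε)).2
  simp [Matrix.trace_smul] at this
  linarith

theorem symm_add_smul_id {T : EucSp n →L[ℝ] EucSp n} (hT : ∀ a b, ⟪T a, b⟫ = ⟪a, T b⟫) (c : ℝ) :
    ∀ a b, ⟪(T + c • ContinuousLinearMap.id ℝ (EucSp n)) a, b⟫ =
      ⟪a, (T + c • ContinuousLinearMap.id ℝ (EucSp n)) b⟫ := by
  intro a b
  simp [inner_add_left, inner_add_right, inner_smul_left, inner_smul_right, hT]

theorem le_of_forall_le_add_mul {x y c : ℝ} (h : ∀ ε > 0, x ≤ y + ε * c) : x ≤ y := by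
  by_contra! hlt
  have h1 := h ((x - y) / (2 * (|c| + 1))) (by have := abs_nonneg c; apply div_pos <;> linarith)
  have h2 : (x - y) / (2 * (|c| + 1)) * c ≤ (x - y) / 2 := by
    rw [div_mul_eq_mul_div, div_le_div_iff₀ (by positivity) (by norm_num)]
    nlinarith [le_abs_self c, abs_nonneg c]
  linarith

/-- Adding `ε ‖x - ξ‖² / 2` to the jet gives a smooth test function with strict contact. Ellipticity
bounds the cost by a multiple of ε, which then tends to 0. -/
theorem IsViscositySubSol.le_of_isSuperjet (hΩ : IsOpen Ω)
    (hF₂ : WeightedUniformlyElliptic α a A F)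
    (hu : ContinuousOn u (closure Ω)) (hs : IsViscositySubSol F Ω (fun x _ => f x) u)
    {ξ p : EucSp n} (hξ : ξ ∈ Ω) (hp : p ≠ 0) {T : EucSp n →L[ℝ] EucSp n}
    (hT : ∀ a b, ⟪T a, b⟫ = ⟪a, T b⟫) (hj : IsSuperjet u ξ p T) :
    f ξ ≤ F p (quadMatrix T) := by
  refine le_of_forall_le_add_mul (c := A * ‖p‖ ^ α * n) fun ε hε => ?_
  refine le_trans ?_ (hF₂.add_smul_one_le hp (quadMatrix_isSymm hT) hε.le)
  rw [← quadMatrix_smul_id, ← quadMatrix_add]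
  set S := T + ε • ContinuousLinearMap.id ℝ (EucSp n)
  have hS := symm_add_smul_id hT ε
  have key := (hs.2 ξ hξ).2 (paraboloid ξ p S) (contDiff_paraboloid ξ p S).contDiffOn ?_
    (by rwa [gradient_paraboloid ξ p S hS])
  · rwa [gradient_paraboloid ξ p S hS, hessianMatrix_paraboloid ξ p S hS] at key
  · filter_upwards [(hj (ε / 4) (by positivity)).filter_mono nhdsWithin_le_nhds,
      (hΩ.mem_nhds hξ : Ω ∈ 𝓝 ξ) |> mem_nhdsWithin_of_mem_nhds, self_mem_nhdsWithin] with x h1 h2 h3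
    rw [(envelopes_eq hu h2).1, (envelopes_eq hu hξ).1]
    have h4 : 0 < ‖x - ξ‖ := norm_pos_iff.2 (sub_ne_zero.2 h3)
    have h5 : paraboloid ξ p S x =
        ⟪p, x - ξ⟫ + (⟪T (x - ξ), x - ξ⟫ + ε * ‖x - ξ‖ ^ 2) / 2 := by
      simp only [paraboloid, S, add_apply, smul_apply, ContinuousLinearMap.id_apply,
        inner_add_left, inner_smul_left, real_inner_self_eq_norm_sq, conj_trivial]
    have h6 : paraboloid ξ p S ξ = 0 := by simp [paraboloid]
    rw [h5, h6]
    nlinarith [mul_pos hε (pow_pos h4 2)]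

/-- A superjet of `-u` is, up to sign, a subjet of u; the paraboloid is now lowered by ε. -/
theorem IsViscositySuperSol.le_of_isSuperjet_neg (hΩ : IsOpen Ω)
    (hF₂ : WeightedUniformlyElliptic α a A F)
    (hu : ContinuousOn u (closure Ω)) (hs : IsViscositySuperSol F Ω (fun x _ => f x) u)
    {ξ p : EucSp n} (hξ : ξ ∈ Ω) (hp : p ≠ 0) {T : EucSp n →L[ℝ] EucSp n}
    (hT : ∀ a b, ⟪T a, b⟫ = ⟪a, T b⟫) (hj : IsSuperjet (fun x => -u x) ξ (-p) (-T)) :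
    F p (quadMatrix T) ≤ f ξ := by
  refine le_of_forall_le_add_mul (c := A * ‖p‖ ^ α * n) fun ε hε => ?_
  set S := T + (-ε) • ContinuousLinearMap.id ℝ (EucSp n)
  have hS := symm_add_smul_id hT (-ε)
  have h0 := hF₂.add_smul_one_le hp (quadMatrix_isSymm hS) hε.le
  have h1 : quadMatrix S + ε • 1 = quadMatrix T := by
    rw [quadMatrix_add, quadMatrix_smul_id]; simp
  rw [h1] at h0
  refine h0.trans (add_le_add_left ?_ _)
  have key := (hs.2 ξ hξ).2 (paraboloid ξ p S) (contDiff_paraboloid ξ p S).contDiffOn ?_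
    (by rwa [gradient_paraboloid ξ p S hS])
  · rwa [gradient_paraboloid ξ p S hS, hessianMatrix_paraboloid ξ p S hS] at key
  · filter_upwards [hj (ε / 4) (by positivity), hΩ.mem_nhds hξ] with x h1 h2
    rw [(envelopes_eq hu h2).2, (envelopes_eq hu hξ).2]
    have h5 : paraboloid ξ p S x =
        ⟪p, x - ξ⟫ + (⟪T (x - ξ), x - ξ⟫ - ε * ‖x - ξ‖ ^ 2) / 2 := by
      simp only [paraboloid, S, add_apply, smul_apply, ContinuousLinearMap.id_apply,
        inner_add_left, inner_smul_left, real_inner_self_eq_norm_sq, conj_trivial]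
      ring
    have h6 : paraboloid ξ p S ξ = 0 := by simp [paraboloid]
    simp only [neg_apply, inner_neg_left] at h1
    rw [h5, h6]
    nlinarith [mul_nonneg hε.le (sq_nonneg ‖x - ξ‖)]

end viscosity

/-! ### Sup-convolution and Lasry–Lions regularization -/

section regularization
variable {E : Type*} [NormedAddCommGroup E]

/-- The sup-convolution of `u` over `K`. -/
noncomputable def supConv (K : Set E) (u : E → ℝ) (c : ℝ) (y : E) : ℝ :=
  sSup ((fun ξ => u ξ - c * ‖y - ξ‖ ^ 2) '' K)

variable {K : Set E} {u : E → ℝ} {c : ℝ}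

theorem exists_supConv_eq (hK : IsCompact K) (hne : K.Nonempty) (hu : ContinuousOn u K) (y : E) :
    ∃ ξ ∈ K, supConv K u c y = u ξ - c * ‖y - ξ‖ ^ 2 := by
  have h : ContinuousOn (fun ξ => u ξ - c * ‖y - ξ‖ ^ 2) K := by fun_prop
  obtain ⟨ξ, hξ, h1, -⟩ := hK.exists_sSup_image_eq_and_ge hne h
  exact ⟨ξ, hξ, h1⟩

theorem le_supConv (hK : IsCompact K) (hu : ContinuousOn u K) {ξ : E} (hξ : ξ ∈ K) (y : E) :
    u ξ - c * ‖y - ξ‖ ^ 2 ≤ supConv K u c y := by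
  have h : ContinuousOn (fun ξ => u ξ - c * ‖y - ξ‖ ^ 2) K := by fun_prop
  exact le_csSup (hK.image_of_continuousOn h).bddAbove ⟨ξ, hξ, rfl⟩

theorem continuous_supConv (hK : IsCompact K) (hu : ContinuousOn u K) :
    Continuous (supConv K u c) := by
  have : CompactSpace K := isCompact_iff_compactSpace.1 hK
  have h0 : Continuous fun ξ : K => u ξ := continuousOn_iff_continuous_domRestrict.1 hu
  have h := (isCompact_univ (X := K)).continuous_sSup (f := fun (y : E) (ξ : K) => u ξ - c * ‖y - ξ‖ ^ 2)
    (by unfold Function.HasUncurry.uncurry Function.hasUncurryInduction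
        exact (h0.comp continuous_snd).sub (continuous_const.mul
          ((continuous_fst.sub (continuous_subtype_val.comp continuous_snd)).norm.pow 2)))
  refine h.congr fun y => ?_
  unfold supConv
  congr 1
  ext r
  simp

theorem norm_add_sq_le_three_halves (a b : E) :
    ‖a + b‖ ^ 2 ≤ 3 / 2 * ‖a‖ ^ 2 + 3 * ‖b‖ ^ 2 := by
  have h := norm_add_le a b
  nlinarith [norm_nonneg (a + b), sq_nonneg (‖a‖ - 2 * ‖b‖)]

theorem norm_add_sq_le_two (a b : E) : ‖a + b‖ ^ 2 ≤ 2 * ‖a‖ ^ 2 + 2 * ‖b‖ ^ 2 := by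
  have h := norm_add_le a b
  nlinarith [norm_nonneg (a + b), sq_nonneg (‖a‖ - ‖b‖)]

/-- The sup-convolution decreases at most like `c ‖y - ξ‖²`, so the penalty `2 c ‖x - y‖²`
dominates; the weights 3/2 and 3 leave a coercive remainder with coefficient `c / 2`. -/
theorem exists_isMin_supConv_add [ProperSpace E] (hK : IsCompact K) (hne : K.Nonempty)
    (hu : ContinuousOn u K) (hc : 0 < c) (x : E) :
    ∃ y, ∀ y', supConv K u c y + 2 * c * ‖x - y‖ ^ 2 ≤ supConv K u c y' + 2 * c * ‖x - y'‖ ^ 2 := by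
  obtain ⟨ξ, hξ⟩ := hne
  have hcont := continuous_supConv (c := c) hK hu
  refine Continuous.exists_forall_le (f := fun y => supConv K u c y + 2 * c * ‖x - y‖ ^ 2)
    (by fun_prop) ?_
  have h1 : Tendsto (fun y => u ξ - 3 * c * ‖x - ξ‖ ^ 2 + c / 2 * dist y x ^ 2) (cocompact E)
      atTop :=
    tendsto_atTop_add_const_left _ _ <| Tendsto.const_mul_atTop (by positivity) <|
      (tendsto_pow_atTop two_ne_zero).comp (tendsto_dist_right_cocompact_atTop x)
  refine tendsto_atTop_mono (fun y => ?_) h1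
  have h2 := le_supConv (c := c) hK hu hξ y
  have h3 := norm_add_sq_le_three_halves (y - x) (x - ξ)
  rw [sub_add_sub_cancel] at h3
  rw [dist_eq_norm, norm_sub_rev x y]
  nlinarith

variable [InnerProductSpace ℝ E]

/-- The exact second-order identity for the squared norm along a segment. -/
theorem norm_sub_sq_convexComb (y h ξ : E) (τ : ℝ) :
    ‖y + τ • h - ξ‖ ^ 2 =
      (1 - τ) * ‖y - ξ‖ ^ 2 + τ * ‖y + h - ξ‖ ^ 2 - τ * (1 - τ) * ‖h‖ ^ 2 := by
  have e1 : y + τ • h - ξ = (y - ξ) + τ • h := by abel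
  have e2 : y + h - ξ = (y - ξ) + h := by abel
  rw [e1, e2, norm_add_sq_real, norm_add_sq_real, inner_smul_right, norm_smul, mul_pow,
    Real.norm_eq_abs, sq_abs]
  ring

/-- Semiconvexity of the sup-convolution. -/
theorem supConv_convexComb_le (hK : IsCompact K) (hne : K.Nonempty) (hu : ContinuousOn u K)
    (y h : E) {τ : ℝ} (h0 : 0 ≤ τ) (h1 : τ ≤ 1) :
    supConv K u c (y + τ • h) ≤
      (1 - τ) * supConv K u c y + τ * supConv K u c (y + h) + c * (τ * (1 - τ) * ‖h‖ ^ 2) := by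
  obtain ⟨ξ, hξ, e⟩ := exists_supConv_eq (c := c) hK hne hu (y + τ • h)
  rw [e, norm_sub_sq_convexComb]
  have a1 := mul_le_mul_of_nonneg_left (le_supConv (c := c) hK hu hξ y) (sub_nonneg.2 h1)
  have a2 := mul_le_mul_of_nonneg_left (le_supConv (c := c) hK hu hξ (y + h)) h0
  linarith

/-- A minimum point of a semiconvex function plus a paraboloid has a lower touching paraboloid. -/
theorem supConv_ge_of_isMin (hK : IsCompact K) (hne : K.Nonempty) (hu : ContinuousOn u K)
    {x y : E} {d : ℝ}
    (hmin : ∀ y', supConv K u c y + d * ‖x - y‖ ^ 2 ≤ supConv K u c y' + d * ‖x - y'‖ ^ 2) (h : E) :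
    supConv K u c y + 2 * d * ⟪x - y, h⟫ - c * ‖h‖ ^ 2 ≤ supConv K u c (y + h) := by
  -- Combine minimality at `y + τ h` with semiconvexity and divide by τ; as τ tends to 0 only the
  -- first-order part of the penalty survives.
  have key : ∀ τ : ℝ, 0 < τ → τ ≤ 1 →
      supConv K u c y + 2 * d * ⟪x - y, h⟫ - c * ‖h‖ ^ 2 ≤
        supConv K u c (y + h) + τ * (d * ‖h‖ ^ 2 - c * ‖h‖ ^ 2) := by
    intro τ h0 h1
    have a1 := hmin (y + τ • h)
    have a2 := supConv_convexComb_le (c := c) hK hne hu y h h0.le h1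
    have e : ‖x - (y + τ • h)‖ ^ 2 = ‖x - y‖ ^ 2 - 2 * τ * ⟪x - y, h⟫ + τ ^ 2 * ‖h‖ ^ 2 := by
      rw [← sub_sub, norm_sub_sq_real, inner_smul_right, norm_smul, mul_pow, Real.norm_eq_abs,
        sq_abs]
      ring
    rw [e] at a1
    have : τ * (supConv K u c y + 2 * d * ⟪x - y, h⟫ - c * ‖h‖ ^ 2) ≤
        τ * (supConv K u c (y + h) + τ * (d * ‖h‖ ^ 2 - c * ‖h‖ ^ 2)) := by linarith
    exact le_of_mul_le_mul_left this h0
  have hlim : Tendsto (fun τ : ℝ => supConv K u c (y + h) + τ * (d * ‖h‖ ^ 2 - c * ‖h‖ ^ 2))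
      (𝓝[>] 0) (𝓝 (supConv K u c (y + h))) := by
    have : Tendsto (fun τ : ℝ => supConv K u c (y + h) + τ * (d * ‖h‖ ^ 2 - c * ‖h‖ ^ 2))
      (𝓝 0) (𝓝 (supConv K u c (y + h) + 0 * (d * ‖h‖ ^ 2 - c * ‖h‖ ^ 2))) :=
      Continuous.tendsto (by fun_prop) 0
    rw [zero_mul, add_zero] at this
    exact this.mono_left nhdsWithin_le_nhds
  refine ge_of_tendsto hlim ?_
  filter_upwards [Ioc_mem_nhdsGT (zero_lt_one' ℝ)] with τ hτ using key τ hτ.1 hτ.2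

/-- Lasry–Lions regularization of a function on a compact set: a `C^{1,1}` function `v` with
gradient `g`, such that quadratic upper bounds for `v` with small constant can only occur at points
which see `u` directly. -/
theorem exists_regularization [ProperSpace E] (hK : IsCompact K) (hne : K.Nonempty)
    (hu : ContinuousOn u K) (hc : 0 < c) :
    ∃ (v : E → ℝ) (g : E → E),
      (∀ x k, |v (x + k) - v x - ⟪g x, k⟫| ≤ 2 * c * ‖k‖ ^ 2) ∧
      (∀ x, ∀ ξ ∈ K, u ξ - 2 * c * ‖x - ξ‖ ^ 2 ≤ v x) ∧
      (∀ x, ∃ ξ ∈ K, v x ≤ u ξ - c * ‖x - ξ‖ ^ 2) ∧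
      (∀ x b, b < 2 * c → (∀ᶠ k in 𝓝 0, v (x + k) ≤ v x + ⟪g x, k⟫ + b * ‖k‖ ^ 2) →
        ∃ ξ ∈ K, v x = u ξ - 2 * c * ‖x - ξ‖ ^ 2) := by
  choose Y hY using exists_isMin_supConv_add hK hne hu hc
  set w := supConv K u c with hw
  set v : E → ℝ := fun x => w (Y x) + 2 * c * ‖x - Y x‖ ^ 2 with hv
  have expand : ∀ a b : E, ‖a + b‖ ^ 2 = ‖a‖ ^ 2 + 2 * ⟪a, b⟫ + ‖b‖ ^ 2 := norm_add_sq_real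
  have hup : ∀ x k, w (Y x) + 2 * c * ‖x + k - Y x‖ ^ 2 =
      v x + ⟪(4 * c) • (x - Y x), k⟫ + 2 * c * ‖k‖ ^ 2 := by
    intro x k
    rw [show x + k - Y x = (x - Y x) + k by abel, expand, inner_smul_left, conj_trivial]
    simp only [hv]; ring
  have hlow : ∀ x, ∀ ξ ∈ K, u ξ - 2 * c * ‖x - ξ‖ ^ 2 ≤ v x := by
    intro x ξ hξ
    have h1 := le_supConv (c := c) hK hu hξ (Y x)
    have h2 := norm_add_sq_le_two (Y x - x) (x - ξ)
    rw [sub_add_sub_cancel, norm_sub_rev (Y x) x] at h2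
    simp only [hv]
    nlinarith
  refine ⟨v, fun x => (4 * c) • (x - Y x), fun x k => abs_le.2 ⟨?_, ?_⟩, hlow, fun x => ?_, ?_⟩
  · have h1 := supConv_ge_of_isMin hK hne hu (hY x) (Y (x + k) - Y x)
    rw [add_sub_cancel] at h1
    have e : x + k - Y (x + k) = (x - Y x) + (k - (Y (x + k) - Y x)) := by abel
    have h2 := norm_add_sq_le_two (k - (Y (x + k) - Y x)) (-k)
    rw [show k - (Y (x + k) - Y x) + -k = -(Y (x + k) - Y x) by abel, norm_neg, norm_neg] at h2
    have h3 : v (x + k) = w (Y (x + k)) + 2 * c * (‖x - Y x‖ ^ 2 +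
        2 * (⟪x - Y x, k⟫ - ⟪x - Y x, Y (x + k) - Y x⟫) + ‖k - (Y (x + k) - Y x)‖ ^ 2) := by
      simp only [hv]
      rw [e, expand, inner_sub_right]
    have h4 : v x = w (Y x) + 2 * c * ‖x - Y x‖ ^ 2 := rfl
    rw [h3, h4, inner_smul_left, conj_trivial]
    nlinarith
  · have h1 := hY (x + k) (Y x)
    have h2 := hup x k
    have h4 : v (x + k) = w (Y (x + k)) + 2 * c * ‖x + k - Y (x + k)‖ ^ 2 := rfl
    linarith
  · obtain ⟨ξ, hξ, h⟩ := exists_supConv_eq (c := c) hK hne hu x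
    refine ⟨ξ, hξ, ?_⟩
    have := hY x x
    rw [sub_self, norm_zero] at this
    rw [← h]
    simp only [hv]; linarith
  · intro x b hb hk
    obtain ⟨ξ, hξ, h⟩ := exists_supConv_eq (c := c) hK hne hu (Y x)
    refine ⟨ξ, hξ, ?_⟩
    -- At the midpoint of `Y x` and ξ the lower bound `hlow` and the upper paraboloid `hup` agree,
    -- so v equals that paraboloid there as well as at x.
    set z : E := (1 / 2 : ℝ) • (Y x + ξ) - x with hz
    have e1 : x + z - ξ = (1 / 2 : ℝ) • (Y x - ξ) := by
      rw [hz]; module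
    have e2 : x + z - Y x = -((1 / 2 : ℝ) • (Y x - ξ)) := by
      rw [hz]; module
    have n1 : ‖(1 / 2 : ℝ) • (Y x - ξ)‖ ^ 2 = ‖Y x - ξ‖ ^ 2 / 4 := by
      rw [norm_smul, mul_pow]; norm_num; ring
    have h1 : v x + ⟪(4 * c) • (x - Y x), z⟫ + 2 * c * ‖z‖ ^ 2 ≤ v (x + z) := by
      have := hlow (x + z) ξ hξ
      rw [← hup, e2, norm_neg, n1]
      rw [e1, n1] at this
      change supConv K u c (Y x) + _ ≤ _
      linarith
    -- An infimum of paraboloids of opening `2 c` minus `2 c ‖·‖²` is concave, so v stays above the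
    -- touching paraboloid on the whole segment from x to `x + z`.
    have h2 : ∀ τ : ℝ, 0 ≤ τ → τ ≤ 1 →
        v x + τ * ⟪(4 * c) • (x - Y x), z⟫ + 2 * c * τ ^ 2 * ‖z‖ ^ 2 ≤ v (x + τ • z) := by
      intro τ h0 h1'
      set y := Y (x + τ • z)
      have e : v (x + τ • z) = w y + 2 * c * ‖x + τ • z - y‖ ^ 2 := rfl
      have a1 := mul_le_mul_of_nonneg_left (hY x y) (sub_nonneg.2 h1')
      have a2 := mul_le_mul_of_nonneg_left (h1.trans (hY (x + z) y)) h0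
      have h4 : v x = w (Y x) + 2 * c * ‖x - Y x‖ ^ 2 := rfl
      rw [e, norm_sub_sq_convexComb]
      rw [← h4] at a1
      linarith
    -- Growth with constant `2 c` along z contradicts the assumed bound `b < 2 c` unless x is itself
    -- the midpoint.
    have hz0 : z = 0 := by
      by_contra hne0
      have hpos : 0 < ‖z‖ := norm_pos_iff.2 hne0
      have t1 : Tendsto (fun τ : ℝ => τ • z) (𝓝[>] 0) (𝓝 0) := by
        have : Tendsto (fun τ : ℝ => τ • z) (𝓝 0) (𝓝 ((0 : ℝ) • z)) :=
          Continuous.tendsto (by fun_prop) 0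
        rw [zero_smul] at this
        exact this.mono_left nhdsWithin_le_nhds
      obtain ⟨τ, ha, hτ⟩ := ((t1.eventually hk).and (Ioc_mem_nhdsGT (zero_lt_one' ℝ))).exists
      have hb2 := h2 τ hτ.1.le hτ.2
      rw [inner_smul_right, norm_smul, mul_pow, Real.norm_eq_abs, sq_abs] at ha
      have : 0 < (2 * c - b) * (τ ^ 2 * ‖z‖ ^ 2) :=
        mul_pos (by linarith) (mul_pos (pow_pos hτ.1 2) (pow_pos hpos 2))
      nlinarith
    have h5 := hup x z
    rw [hz0, inner_zero_right, norm_zero] at h5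
    rw [hz0] at e1 e2
    rw [add_zero] at e1 e2 h5
    rw [e1, n1]
    rw [e2, norm_neg, n1] at h5
    change supConv K u c (Y x) + _ = _ at h5
    linarith

end regularization

/-! ### Functions of class `C^{1,1}` and their second-order expansions -/

section C11
variable {E : Type*} [NormedAddCommGroup E] [InnerProductSpace ℝ E] {v : E → ℝ} {g : E → E} {C : ℝ}

theorem eq_zero_of_inner_le_sq {a : E} (h : ∀ᶠ k in 𝓝 (0 : E), ⟪a, k⟫ ≤ C * ‖k‖ ^ 2) : a = 0 := by
  by_contra hne
  have hpos : 0 < ‖a‖ := norm_pos_iff.2 hne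
  have t1 : Tendsto (fun τ : ℝ => τ • a) (𝓝[>] 0) (𝓝 0) := by
    have : Tendsto (fun τ : ℝ => τ • a) (𝓝 0) (𝓝 ((0 : ℝ) • a)) :=
      Continuous.tendsto (by fun_prop) 0
    rw [zero_smul] at this
    exact this.mono_left nhdsWithin_le_nhds
  have t2 : Ioo (0 : ℝ) (1 / (|C| + 1)) ∈ 𝓝[>] (0 : ℝ) :=
    Ioo_mem_nhdsGT (by positivity)
  obtain ⟨τ, ha, h0, h1⟩ := ((t1.eventually h).and t2).exists
  rw [inner_smul_right, real_inner_self_eq_norm_sq, norm_smul, mul_pow, Real.norm_eq_abs,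
    sq_abs] at ha
  rw [lt_div_iff₀ (by positivity)] at h1
  have h2 : τ * C ≤ τ * |C| := mul_le_mul_of_nonneg_left (le_abs_self C) h0.le
  have h3 : 0 < (τ * ‖a‖ ^ 2) * (1 - τ * C) := mul_pos (by positivity) (by linarith)
  nlinarith

/-- Expand v at `y + k` from both x and y, with k of length `‖x - y‖` along `g x - g y`. The three
remainders contribute `1 + 4 + 1 = 6` times `C ‖x - y‖²`. -/
theorem lipschitzWith_of_abs_sub_inner_le (hC : 0 ≤ C)
    (h : ∀ x k, |v (x + k) - v x - ⟪g x, k⟫| ≤ C * ‖k‖ ^ 2) :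
    LipschitzWith (Real.toNNReal (6 * C)) g := by
  refine LipschitzWith.of_dist_le' fun x y => ?_
  rw [dist_eq_norm, dist_eq_norm]
  rcases eq_or_ne (g x) (g y) with he | he
  · rw [he, sub_self, norm_zero]; positivity
  have hpos : 0 < ‖g x - g y‖ := norm_pos_iff.2 (sub_ne_zero.2 he)
  rcases eq_or_ne x y with rfl | hxy
  · exact absurd rfl he
  have hr : 0 < ‖x - y‖ := norm_pos_iff.2 (sub_ne_zero.2 hxy)
  set k : E := (‖x - y‖ / ‖g x - g y‖) • (g x - g y) with hk
  have nk : ‖k‖ = ‖x - y‖ := by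
    rw [hk, norm_smul, norm_div, norm_norm, norm_norm, div_mul_cancel₀ _ hpos.ne']
  have ik : ⟪g x - g y, k⟫ = ‖x - y‖ * ‖g x - g y‖ := by
    rw [hk, inner_smul_right, real_inner_self_eq_norm_sq]
    field_simp
  have h1 := abs_le.1 (h y k)
  have h2 := abs_le.1 (h x (y + k - x))
  have h3 := abs_le.1 (h x (y - x))
  rw [add_sub_cancel] at h2 h3
  rw [nk] at h1
  have h4 : ‖y + k - x‖ ^ 2 ≤ 4 * ‖x - y‖ ^ 2 := by
    have := norm_add_sq_le_two (y - x) k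
    rw [show y - x + k = y + k - x by abel, nk, norm_sub_rev y x] at this
    linarith
  rw [norm_sub_rev y x] at h3
  have h5 : ⟪g x, y + k - x⟫ = ⟪g x, k⟫ + ⟪g x, y - x⟫ := by
    rw [← inner_add_right]; congr 1; abel
  rw [inner_sub_left] at ik
  have h6 : ‖x - y‖ * ‖g x - g y‖ ≤ ‖x - y‖ * (6 * C * ‖x - y‖) := by
    nlinarith [mul_le_mul_of_nonneg_left h4 hC]
  exact le_of_mul_le_mul_left h6 hr

theorem hasFDerivAt_of_abs_sub_inner_le
    (h : ∀ x k, |v (x + k) - v x - ⟪g x, k⟫| ≤ C * ‖k‖ ^ 2) (x : E) :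
    HasFDerivAt v (innerSL ℝ (g x)) x := by
  rw [hasFDerivAt_iff_isLittleO_nhds_zero]
  have h1 : (fun k => v (x + k) - v x - innerSL ℝ (g x) k) =O[𝓝 0] fun k : E => ‖k‖ ^ 2 := by
    refine Asymptotics.IsBigO.of_bound C (Eventually.of_forall fun k => ?_)
    simpa using h x k
  exact h1.trans_isLittleO (Asymptotics.isLittleO_norm_pow_id one_lt_two)

theorem symm_of_hasFDerivAt_gradient [CompleteSpace E] (hv : ∀ x, HasFDerivAt v (innerSL ℝ (g x)) x)
    {x : E} {T : E →L[ℝ] E} (hT : HasFDerivAt g T x) (a b : E) : ⟪T a, b⟫ = ⟪a, T b⟫ := by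
  have h2 : HasFDerivAt (fun x => innerSL ℝ (g x)) ((innerSL ℝ).comp T) x :=
    (innerSL ℝ).hasFDerivAt.comp x hT
  have := second_derivative_symmetric hv h2 a b
  simp at this
  rw [this, real_inner_comm]

/-- The remainder has gradient `g (x + y) - g x - T y`, which is small relative to y because g is
differentiable at the single point x; the mean value inequality concludes. -/
theorem taylor_two_of_hasFDerivAt_gradient [CompleteSpace E]
    (hv : ∀ x, HasFDerivAt v (innerSL ℝ (g x)) x)
    {x : E} {T : E →L[ℝ] E} (hT : HasFDerivAt g T x) {ε : ℝ} (hε : 0 < ε) :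
    ∀ᶠ k in 𝓝 (0 : E), |v (x + k) - v x - ⟪g x, k⟫ - ⟪T k, k⟫ / 2| ≤ ε * ‖k‖ ^ 2 := by
  have hsymm := symm_of_hasFDerivAt_gradient hv hT
  have h0 := (hasFDerivAt_iff_isLittleO_nhds_zero.1 hT).def hε
  obtain ⟨ρ, hρ, h1⟩ := Metric.eventually_nhds_iff_ball.1 h0
  filter_upwards [Metric.ball_mem_nhds (0 : E) hρ] with k hk
  have hd : ∀ y, HasFDerivAt (fun k => v (x + k) - v x - ⟪g x, k⟫ - ⟪T k, k⟫ / 2)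
      (innerSL ℝ (g (x + y) - g x - T y)) y := by
    intro y
    have e1 : HasFDerivAt (fun k => v (x + k)) (innerSL ℝ (g (x + y))) y := by
      have := (hv (x + y)).comp y ((hasFDerivAt_id y).const_add x)
      rw [ContinuousLinearMap.comp_id] at this
      exact this
    have e2 : HasFDerivAt (fun k => ⟪g x, k⟫) (innerSL ℝ (g x)) y := (innerSL ℝ (g x)).hasFDerivAt
    have e3 := (T.hasFDerivAt (x := y)).inner ℝ (hasFDerivAt_id y)
    have e4 := ((e1.sub_const (v x)).sub e2).sub (e3.mul_const (1 / 2 : ℝ))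
    refine HasFDerivAt.congr_of_eventuallyEq (e4.congr_fderiv ?_)
      (Eventually.of_forall fun x => by simp [div_eq_mul_inv])
    ext w
    simp [fderivInnerCLM_apply]
    rw [hsymm w, real_inner_comm (T y) w]
    ring
  have hb : ∀ y ∈ Metric.closedBall (0 : E) ‖k‖,
      ‖innerSL ℝ (g (x + y) - g x - T y)‖ ≤ ε * ‖k‖ := by
    intro y hy
    rw [mem_closedBall_zero_iff] at hy
    rw [mem_ball_zero_iff] at hk
    rw [innerSL_apply_norm]
    exact (h1 y (mem_ball_zero_iff.2 (hy.trans_lt hk))).trans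
      (mul_le_mul_of_nonneg_left hy hε.le)
  have := (convex_closedBall (0 : E) ‖k‖).norm_image_sub_le_of_norm_hasFDerivWithin_le
    (fun y _ => (hd y).hasFDerivWithinAt) hb
    (Metric.mem_closedBall_self (norm_nonneg k)) (show k ∈ _ by simp)
  simp only [add_zero, sub_self, inner_zero_right, map_zero, zero_div, sub_zero,
    Real.norm_eq_abs] at this
  linarith

end C11

/-! ### Differentiability points among perturbed maxima -/

open MeasureTheory Module in
/-- If a Lipschitz map sends some chosen preimages onto a ball, then one of these is a point of
differentiability of another given Lipschitz map. -/
theorem exists_differentiableAt_of_lipschitzOnWith {X Y : Type*} [NormedAddCommGroup X]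
    [NormedSpace ℝ X] [FiniteDimensional ℝ X] [NormedAddCommGroup Y]
    [NormedSpace ℝ Y] [FiniteDimensional ℝ Y] {G : X → X} {D : X → Y} {S : Set X} {C C' : NNReal}
    (hG : LipschitzOnWith C G S) (hD : LipschitzWith C' D) {z : X → X} {r : ℝ} (hr : 0 < r)
    (hz : ∀ p ∈ Metric.ball (0 : X) r, z p ∈ S ∧ G (z p) = p) :
    ∃ p ∈ Metric.ball (0 : X) r, DifferentiableAt ℝ D (z p) := by
  borelize X
  by_contra! hcon
  have hN : μH[finrank ℝ X] {x | ¬ DifferentiableAt ℝ D x} = 0 :=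
    hD.ae_differentiableAt (μ := μH[finrank ℝ X])
  -- If every chosen point were bad, the ball would be the Lipschitz image of a Rademacher null set,
  -- hence null.
  have h1 : Metric.ball (0 : X) r ⊆ G '' (S ∩ {x | ¬ DifferentiableAt ℝ D x}) :=
    fun p hp => ⟨z p, ⟨(hz p hp).1, hcon p hp⟩, (hz p hp).2⟩
  have h2 := (hG.mono inter_subset_left).hausdorffMeasure_image_le
    (s := S ∩ {x | ¬ DifferentiableAt ℝ D x}) (d := finrank ℝ X) (by positivity)
  rw [measure_mono_null inter_subset_right hN, mul_zero] at h2
  have h3 : μH[finrank ℝ X] (Metric.ball (0 : X) r) = 0 :=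
    measure_mono_null h1 (nonpos_iff_eq_zero.1 h2)
  exact (Metric.measure_ball_pos _ (0 : X) hr).ne' h3

/-! ### Uniform exterior balls -/

section exteriorBall
variable {n : ℕ} {Ω : Set (EucSp n)}

/-- The inequality says that y lies outside the open ball of radius R centred at `z + R ν`, with ν
the normalized gradient of ρ. Inside that ball the linear part of ρ would dominate its quadratic
error, forcing `ρ y ≥ 0`. The bound `r / 4` keeps offending points in the good neighbourhood; the
bound with `m` and `K` beats the error. -/
theorem exists_exterior_ball_near {ρ : EucSp n → ℝ} {z₀ : EucSp n} (hΩ : IsOpen Ω)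
    (hρ : ContDiffAt ℝ 2 ρ z₀) (hg : gradient ρ z₀ ≠ 0)
    (hiff : ∀ᶠ x in 𝓝 z₀, (x ∈ Ω ↔ ρ x < 0)) :
    ∃ R > 0, ∀ᶠ z in 𝓝 z₀, z ∈ frontier Ω →
      ∃ ν : EucSp n, ‖ν‖ = 1 ∧ ∀ y ∈ Ω, 2 * R * ⟪ν, y - z⟫ ≤ ‖y - z‖ ^ 2 := by
  have h1 : ContDiffAt ℝ 1 (fderiv ℝ ρ) z₀ := hρ.fderiv_right (by norm_num)
  obtain ⟨K, t, ht, hK⟩ := h1.exists_lipschitzOnWith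
  have hdiff : ∀ᶠ x in 𝓝 z₀, DifferentiableAt ℝ ρ x :=
    (hρ.eventually (by simp)).mono fun x hx => hx.differentiableAt (by simp)
  set m := ‖gradient ρ z₀‖ / 2 with hm
  have hm0 : 0 < m := by have := norm_pos_iff.2 hg; positivity
  have hgn : ∀ x, ‖gradient ρ x‖ = ‖fderiv ℝ ρ x‖ := fun x => by simp [gradient]
  have hlow : ∀ᶠ x in 𝓝 z₀, m < ‖gradient ρ x‖ := by
    have hc : ContinuousAt (fun x => ‖gradient ρ x‖) z₀ := by
      simp only [hgn]; exact h1.continuousAt.norm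
    exact hc.eventually (lt_mem_nhds (by linarith))
  obtain ⟨r, hr, hall⟩ := Metric.eventually_nhds_iff_ball.1
    ((hiff.and hdiff).and (hlow.and ht))
  refine ⟨min (r / 4) (m / (2 * (K + 1))), lt_min (by positivity) (by positivity), ?_⟩
  set R := min (r / 4) (m / (2 * (K + 1)))
  have hR1 : R ≤ r / 4 := min_le_left _ _
  have hR2 : 2 * R * (K + 1) ≤ m := by
    have : R ≤ m / (2 * (K + 1)) := min_le_right _ _
    rw [le_div_iff₀ (by positivity)] at this
    linarith
  have hR0 : 0 < R := lt_min (by positivity) (by positivity)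
  filter_upwards [Metric.ball_mem_nhds z₀ (half_pos hr)] with z hz hzf
  have hzr : z ∈ Metric.ball z₀ r := Metric.ball_subset_ball (by linarith) hz
  have hgz := (hall z hzr).2.1
  have hgz0 : 0 < ‖gradient ρ z‖ := hm0.trans hgz
  refine ⟨(1 / ‖gradient ρ z‖) • gradient ρ z, ?_, fun y hy => ?_⟩
  · rw [norm_smul, norm_div, norm_one, norm_norm, one_div_mul_cancel hgz0.ne']
  by_contra! hcon
  set ν := (1 / ‖gradient ρ z‖) • gradient ρ z with hν
  have hν1 : ‖ν‖ = 1 := by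
    rw [norm_smul, norm_div, norm_one, norm_norm, one_div_mul_cancel hgz0.ne']
  have hcs : ⟪ν, y - z⟫ ≤ ‖y - z‖ := by
    have := real_inner_le_norm ν (y - z); rwa [hν1, one_mul] at this
  have hsmall : ‖y - z‖ < 2 * R := by
    by_contra! hge
    nlinarith [norm_nonneg (y - z)]
  have hyr : y ∈ Metric.ball z₀ r := by
    rw [Metric.mem_ball] at hz ⊢
    have := dist_triangle y z z₀
    rw [dist_eq_norm y z] at this
    linarith
  have hpos : 0 < ⟪ν, y - z⟫ := by
    by_contra! hle
    nlinarith [sq_nonneg ‖y - z‖, mul_nonneg hR0.le (neg_nonneg.2 hle)]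
  have hest := ((convex_ball z₀ r).inter (convex_closedBall z ‖y - z‖)).norm_image_sub_le_of_norm_fderiv_le'
    (𝕜 := ℝ) (f := ρ) (φ := fderiv ℝ ρ z) (C := K * ‖y - z‖) (x := z) (y := y)
    (fun x hx => (hall x hx.1).1.2)
    (fun x hx => by
      have h2 := hK.norm_sub_le (hall x hx.1).2.2 (hall z hzr).2.2
      refine h2.trans (mul_le_mul_of_nonneg_left ?_ K.2)
      have := hx.2
      rwa [mem_closedBall_iff_norm] at this)
    ⟨hzr, Metric.mem_closedBall_self (norm_nonneg _)⟩
    ⟨hyr, mem_closedBall_iff_norm.2 le_rfl⟩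
  have hzρ : 0 ≤ ρ z := by
    have hzn : z ∉ Ω := fun h => hzf.2 (by rwa [hΩ.interior_eq])
    have := (hall z hzr).1.1
    by_contra! hlt
    exact hzn (this.2 hlt)
  have hyρ : ρ y < 0 := (hall y hyr).1.1.1 hy
  have hfd : fderiv ℝ ρ z (y - z) = ‖gradient ρ z‖ * ⟪ν, y - z⟫ := by
    rw [hν, inner_smul_left, conj_trivial, ← mul_assoc, mul_one_div_cancel hgz0.ne', one_mul]
    simp [gradient]
  rw [hfd, Real.norm_eq_abs] at hest
  have h3 := (abs_le.1 hest).1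
  have h4 : m * ⟪ν, y - z⟫ ≤ ‖gradient ρ z‖ * ⟪ν, y - z⟫ :=
    mul_le_mul_of_nonneg_right hgz.le hpos.le
  have h5 : 2 * R * (K + 1) * ⟪ν, y - z⟫ ≤ m * ⟪ν, y - z⟫ :=
    mul_le_mul_of_nonneg_right hR2 hpos.le
  have hK0 : (0 : ℝ) ≤ K := K.2
  nlinarith [mul_pos hR0 hpos]

theorem IsBoundedC2Domain.exists_uniform_exterior_ball (hΩ : IsBoundedC2Domain Ω) :
    ∃ R > 0, ∀ z ∈ frontier Ω, ∃ c : EucSp n, ‖z - c‖ = R ∧ ∀ y ∈ closure Ω, R ≤ ‖y - c‖ := by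
  have hcomp : IsCompact (frontier Ω) :=
    Metric.isCompact_of_isClosed_isBounded isClosed_frontier
      (hΩ.2.1.closure.subset frontier_subset_closure)
  have key : ∃ R > 0, ∀ z ∈ frontier Ω, z ∈ frontier Ω →
      ∃ ν : EucSp n, ‖ν‖ = 1 ∧ ∀ y ∈ Ω, 2 * R * ⟪ν, y - z⟫ ≤ ‖y - z‖ ^ 2 := by
    refine hcomp.induction_on (p := fun s => ∃ R > 0, ∀ z ∈ s, z ∈ frontier Ω →
      ∃ ν : EucSp n, ‖ν‖ = 1 ∧ ∀ y ∈ Ω, 2 * R * ⟪ν, y - z⟫ ≤ ‖y - z‖ ^ 2) ?_ ?_ ?_ ?_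
    · exact ⟨1, one_pos, fun z hz => absurd hz (notMem_empty z)⟩
    · rintro s t hst ⟨R, hR, h⟩
      exact ⟨R, hR, fun z hz => h z (hst hz)⟩
    · have mono : ∀ {R R' : ℝ} {ν w : EucSp n}, 0 < R' → R' ≤ R →
          2 * R * ⟪ν, w⟫ ≤ ‖w‖ ^ 2 → 2 * R' * ⟪ν, w⟫ ≤ ‖w‖ ^ 2 := by
        intro R R' ν w h0 h1 h2
        rcases le_total 0 ⟪ν, w⟫ with h | h
        · nlinarith
        · nlinarith [sq_nonneg ‖w‖]
      rintro s t ⟨R, hR, h⟩ ⟨R', hR', h'⟩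
      refine ⟨min R R', lt_min hR hR', fun z hz hzf => ?_⟩
      rcases hz with hz | hz
      · obtain ⟨ν, h1, h2⟩ := h z hz hzf
        exact ⟨ν, h1, fun y hy => mono (lt_min hR hR') (min_le_left _ _) (h2 y hy)⟩
      · obtain ⟨ν, h1, h2⟩ := h' z hz hzf
        exact ⟨ν, h1, fun y hy => mono (lt_min hR hR') (min_le_right _ _) (h2 y hy)⟩
    · intro z hz
      obtain ⟨ρ, h1, h2, h3⟩ := hΩ.2.2 z hz
      obtain ⟨R, hR, h⟩ := exists_exterior_ball_near hΩ.1 h1 h2 h3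
      exact ⟨_, mem_nhdsWithin_of_mem_nhds h, R, hR, fun z hz => hz⟩
  obtain ⟨R, hR, h⟩ := key
  refine ⟨R, hR, fun z hz => ?_⟩
  obtain ⟨ν, h1, h2⟩ := h z hz hz
  refine ⟨z + R • ν, ?_, fun y hy => ?_⟩
  · rw [sub_add_cancel_left, norm_neg, norm_smul, h1, mul_one, Real.norm_of_nonneg hR.le]
  · refine closure_minimal (t := {y | R ≤ ‖y - (z + R • ν)‖}) (fun y hy => ?_)
      (isClosed_le continuous_const (by fun_prop)) hy
    refine abs_le_of_sq_le_sq' ?_ (norm_nonneg _) |>.2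
    rw [← sub_sub, norm_sub_sq_real, inner_smul_right, norm_smul, h1, mul_one,
      Real.norm_of_nonneg hR.le, real_inner_comm]
    linarith [h2 y hy]

end exteriorBall

/-! ### Radial barriers and linear growth at the boundary -/

section barrier
variable {n : ℕ} {α a A : ℝ} {F : SecondOrderOp n} {Ω : Set (EucSp n)} {f u : EucSp n → ℝ}

theorem HomogeneousElliptic.apply_zero (hF₁ : HomogeneousElliptic α F) {p : EucSp n} (hp : p ≠ 0) :
    F p 0 = 0 := by
  have := hF₁.1 p 0 1 2 hp (by simp [Matrix.IsSymm]) one_ne_zero two_pos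
  simp at this
  linarith

theorem WeightedUniformlyElliptic.add_inner_le (hF₂ : WeightedUniformlyElliptic α a A F)
    (ha : 0 ≤ a) {p e : EucSp n} (hp : p ≠ 0) (he : ‖e‖ = 1) {M : Matrix (Fin n) (Fin n) ℝ}
    (hM : M.IsSymm) {P : EucSp n →L[ℝ] EucSp n} (hP : ∀ a b, ⟪P a, b⟫ = ⟪a, P b⟫)
    (h0 : ∀ a, 0 ≤ ⟪P a, a⟫) :
    F p M + a * ‖p‖ ^ α * ⟪P e, e⟫ ≤ F p (M + quadMatrix P) := by
  have h1 := (hF₂ p M _ hp hM (quadMatrix_posSemidef hP h0)).1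
  have h2 := inner_le_trace_quadMatrix hP h0 e
  rw [he, one_pow, mul_one] at h2
  have h3 : 0 ≤ a * ‖p‖ ^ α := mul_nonneg ha (Real.rpow_nonneg (norm_nonneg p) α)
  linarith [mul_le_mul_of_nonneg_left h2 h3]

/-- The operator `h ↦ c h - s ⟪v, h⟫ v`. -/
noncomputable def radialHessian (c s : ℝ) (v : EucSp n) : EucSp n →L[ℝ] EucSp n :=
  c • ContinuousLinearMap.id ℝ (EucSp n) - s • (innerSL ℝ v).smulRight v

theorem inner_radialHessian (c s : ℝ) (v x y : EucSp n) :
    ⟪radialHessian c s v x, y⟫ = c * ⟪x, y⟫ - s * (⟪v, x⟫ * ⟪v, y⟫) := by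
  simp [radialHessian, inner_sub_left, inner_smul_left]

theorem radialHessian_symm (c s : ℝ) (v x y : EucSp n) :
    ⟪radialHessian c s v x, y⟫ = ⟪x, radialHessian c s v y⟫ := by
  rw [real_inner_comm _ x, inner_radialHessian, inner_radialHessian, real_inner_comm x y]
  ring

/-- Adding the rank-one form back gives `c` times the identity. The upper ellipticity bound controls
that multiple, and the lower one credits the rank-one part. -/
theorem apply_radialHessian_le (hF₁ : HomogeneousElliptic α F)
    (hF₂ : WeightedUniformlyElliptic α a A F) (ha : 0 ≤ a) {p v : EucSp n} (hp : p ≠ 0)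
    (hv : v ≠ 0) {c s : ℝ} (hc : 0 ≤ c) (hs : 0 ≤ s) :
    F p (quadMatrix (radialHessian c s v)) ≤ ‖p‖ ^ α * (A * n * c - a * (s * ‖v‖ ^ 2)) := by
  have hv0 : 0 < ‖v‖ := norm_pos_iff.2 hv
  have hinn : ∀ x y, ⟪(s • (innerSL ℝ v).smulRight v : EucSp n →L[ℝ] EucSp n) x, y⟫ =
      s * (⟪v, x⟫ * ⟪v, y⟫) := fun x y => by simp [inner_smul_left]
  have h1 := hF₂.add_inner_le ha (e := (1 / ‖v‖) • v) hp
    (by rw [norm_smul, norm_div, norm_one, norm_norm, one_div_mul_cancel hv0.ne'])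
    (quadMatrix_isSymm (radialHessian_symm c s v))
    (P := s • (innerSL ℝ v).smulRight v)
    (fun x y => by rw [real_inner_comm _ x, hinn, hinn, mul_comm ⟪v, x⟫])
    (fun x => by rw [hinn]; exact mul_nonneg hs (mul_self_nonneg _))
  rw [hinn, ← quadMatrix_add, inner_smul_right, real_inner_self_eq_norm_sq] at h1
  have h2 : radialHessian c s v + s • (innerSL ℝ v).smulRight v =
      c • ContinuousLinearMap.id ℝ (EucSp n) := by simp [radialHessian]
  have h3 := hF₂.add_smul_one_le (M := 0) hp (by simp [Matrix.IsSymm]) hc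
  rw [h2, quadMatrix_smul_id] at h1
  rw [zero_add, hF₁.apply_zero hp] at h3
  have h4 : s * (1 / ‖v‖ * ‖v‖ ^ 2 * (1 / ‖v‖ * ‖v‖ ^ 2)) = s * ‖v‖ ^ 2 := by field_simp
  rw [h4] at h1
  linarith

/-- The radial polynomial barrier `τ ↦ K (m τ - τ ^ 2)` with `τ = ‖x - c‖ ^ 2 - R ^ 2`. -/
noncomputable def radialBarrier (K m R : ℝ) (c x : EucSp n) : ℝ :=
  K * (m * (‖x - c‖ ^ 2 - R ^ 2) - (‖x - c‖ ^ 2 - R ^ 2) ^ 2)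

/-- The barrier is a polynomial, so its expansion is exact: the quartic term has a good sign, and
the neighbourhood is chosen so that ε absorbs the cubic term. -/
theorem isSuperjet_of_sub_radialBarrier {K m R : ℝ} (hK : 0 ≤ K) {c ξ : EucSp n}
    (h : ∀ᶠ x in 𝓝 ξ, u x ≤ u ξ + (radialBarrier K m R c x - radialBarrier K m R c ξ)) :
    IsSuperjet u ξ ((2 * K * (m - 2 * (‖ξ - c‖ ^ 2 - R ^ 2))) • (ξ - c))
      (radialHessian (2 * K * (m - 2 * (‖ξ - c‖ ^ 2 - R ^ 2))) (8 * K) (ξ - c)) := by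
  intro ε hε
  have hball : Metric.ball ξ (ε / (4 * K * ‖ξ - c‖ + 1)) ∈ 𝓝 ξ :=
    Metric.ball_mem_nhds _ (by positivity)
  filter_upwards [h, hball] with x hx hb
  rw [mem_ball_iff_norm, lt_div_iff₀ (by positivity)] at hb
  refine hx.trans ?_
  rw [inner_radialHessian, inner_smul_left, conj_trivial, real_inner_self_eq_norm_sq]
  have e : ‖x - c‖ ^ 2 = ‖ξ - c‖ ^ 2 + 2 * ⟪ξ - c, x - ξ⟫ + ‖x - ξ‖ ^ 2 := by
    rw [← norm_add_sq_real, sub_add_sub_cancel']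
  simp only [radialBarrier]
  rw [e]
  have hcs := (abs_le.1 (abs_real_inner_le_norm (ξ - c) (x - ξ))).1
  set d := ⟪ξ - c, x - ξ⟫
  set N := ‖x - ξ‖
  set V := ‖ξ - c‖
  have hN : 0 ≤ N := norm_nonneg _
  have h1 : 4 * K * (-(V * N)) * N ^ 2 ≤ 4 * K * d * N ^ 2 := by gcongr
  have h2 : 4 * K * V * N * N ^ 2 ≤ ε * N ^ 2 := by
    refine mul_le_mul_of_nonneg_right ?_ (sq_nonneg N)
    nlinarith
  have h3 : 0 ≤ K * N ^ 4 := by positivity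
  nlinarith

/-- The barrier is a strict supersolution in the shell where it is used. -/
theorem apply_radialBarrier_lt (hα : -1 < α) (ha : 0 < a) (hA : 0 < A)
    (hF₁ : HomogeneousElliptic α F) (hF₂ : WeightedUniformlyElliptic α a A F)
    {R V m K C τ : ℝ} (hR : 0 < R) (hV : 0 < V) (hm : 0 < m) (hm1 : A * n * m ≤ a * R ^ 2)
    (hK : 0 < K) (hKC : C < 6 * a * R ^ 2 * ((K * m * R) ^ (1 + α) / (2 * m * V)))
    {v : EucSp n} (hv1 : R ≤ ‖v‖) (hv2 : ‖v‖ ≤ V) (hτ0 : 0 ≤ τ) (hτ1 : τ ≤ m / 4) :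
    (2 * K * (m - 2 * τ)) • v ≠ 0 ∧
    F ((2 * K * (m - 2 * τ)) • v)
      (quadMatrix (radialHessian (2 * K * (m - 2 * τ)) (8 * K) v)) < -C := by
  have hv0 : 0 < ‖v‖ := hR.trans_le hv1
  have hb1 : K * m ≤ 2 * K * (m - 2 * τ) := by nlinarith
  have hb2 : 2 * K * (m - 2 * τ) ≤ 2 * K * m := by nlinarith
  generalize 2 * K * (m - 2 * τ) = b at *
  have hb0 : 0 < b := (mul_pos hK hm).trans_le hb1
  have hp : b • v ≠ 0 := smul_ne_zero hb0.ne' (norm_pos_iff.1 hv0)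
  refine ⟨hp, (apply_radialHessian_le hF₁ hF₂ ha.le hp (norm_pos_iff.1 hv0) hb0.le
    (by positivity : 0 ≤ 8 * K)).trans_lt ?_⟩
  have hnp : ‖b • v‖ = b * ‖v‖ := by rw [norm_smul, Real.norm_of_nonneg hb0.le]
  have hq0 : 0 < ‖b • v‖ := norm_pos_iff.2 hp
  have hq1 : K * m * R ≤ ‖b • v‖ := by rw [hnp]; gcongr
  have hq2 : ‖b • v‖ ≤ K * (2 * m * V) := by
    rw [hnp]
    calc b * ‖v‖ ≤ (2 * K * m) * V := by gcongr
      _ = _ := by ring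
  generalize ‖b • v‖ = q at *
  have hqα : 0 < q ^ α := Real.rpow_pos_of_pos hq0 α
  -- The tangential cost is at most `2 a R² K` by the choice of m, against a radial gain of at least
  -- `8 a R² K`.
  have hstep : A * n * b - a * (8 * K * ‖v‖ ^ 2) ≤ -(6 * a * R ^ 2 * K) := by
    have h1 : A * n * b ≤ A * n * (2 * K * m) := by gcongr
    have h2 : R ^ 2 ≤ ‖v‖ ^ 2 := by gcongr
    have h3 : a * K * R ^ 2 ≤ a * K * ‖v‖ ^ 2 := by gcongr
    have h4 := mul_le_mul_of_nonneg_left hm1 hK.le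
    linarith
  -- The sign of α is unknown, so monotonicity is used for `q ^ (1 + α)` and one factor q is then
  -- bounded above.
  have hpow : (K * m * R) ^ (1 + α) / (2 * m * V) ≤ q ^ α * K := by
    rw [div_le_iff₀ (by positivity)]
    calc (K * m * R) ^ (1 + α) ≤ q ^ (1 + α) :=
          Real.rpow_le_rpow (by positivity) hq1 (by linarith)
      _ = q * q ^ α := by rw [Real.rpow_add hq0, Real.rpow_one]
      _ ≤ K * (2 * m * V) * q ^ α := by gcongr
      _ = _ := by ring
  have h5 := mul_le_mul_of_nonneg_left hstep hqα.le
  have h6 := mul_le_mul_of_nonneg_left hpow (by positivity : 0 ≤ 6 * a * R ^ 2)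
  linarith

/-- A positive maximum of u minus the barrier is excluded on ∂Ω, where `u = 0`, and on the outer
sphere `τ = m / 4`, where the barrier equals `3 K m² / 16 ≥ B`. At an interior point the jet of the
barrier violates the subsolution inequality. -/
theorem le_radialBarrier (hΩ : IsOpen Ω) (hcomp : IsCompact (closure Ω))
    (hF₂ : WeightedUniformlyElliptic α a A F)
    (hu : ContinuousOn u (closure Ω)) (hs : IsViscositySubSol F Ω (fun x _ => f x) u)
    (hb : ∀ x ∈ frontier Ω, u x = 0) {K m R B C : ℝ} {c : EucSp n} (hR : 0 < R) (hm : 0 < m)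
    (hK : 0 < K) (hC : ∀ x ∈ Ω, -C ≤ f x) (hB : ∀ x ∈ closure Ω, u x ≤ B)
    (hKB : B ≤ K * (3 * m ^ 2 / 16)) (hc : ∀ x ∈ closure Ω, R ≤ ‖x - c‖)
    (hlt : ∀ x ∈ closure Ω, ∀ τ, 0 ≤ τ → τ ≤ m / 4 →
      (2 * K * (m - 2 * τ)) • (x - c) ≠ 0 ∧ F ((2 * K * (m - 2 * τ)) • (x - c))
        (quadMatrix (radialHessian (2 * K * (m - 2 * τ)) (8 * K) (x - c))) < -C) :
    ∀ x ∈ closure Ω, ‖x - c‖ ^ 2 - R ^ 2 ≤ m / 4 → u x ≤ radialBarrier K m R c x := by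
  by_contra! hcon
  obtain ⟨x₁, hx₁, hx₁τ, hx₁u⟩ := hcon
  have hclosed : IsClosed {x : EucSp n | ‖x - c‖ ^ 2 - R ^ 2 ≤ m / 4} :=
    isClosed_le (by fun_prop) continuous_const
  obtain ⟨ξ, ⟨hξ, hξτ⟩, hmax⟩ := (hcomp.inter_right hclosed).exists_isMaxOn ⟨x₁, hx₁, hx₁τ⟩
    (f := fun x => u x - radialBarrier K m R c x)
    ((hu.mono inter_subset_left).sub (by unfold radialBarrier; fun_prop))
  have hpos : 0 < u ξ - radialBarrier K m R c ξ :=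
    (sub_pos.2 hx₁u).trans_le (hmax ⟨hx₁, hx₁τ⟩)
  rw [mem_ofPred_eq] at hξτ
  have hRξ := hc ξ hξ
  set τ := ‖ξ - c‖ ^ 2 - R ^ 2 with hτ
  have hτ0 : 0 ≤ τ := by
    rw [hτ]; nlinarith
  have hφ : radialBarrier K m R c ξ = K * (m * τ - τ ^ 2) := rfl
  have hφ0 : 0 ≤ K * (m * τ - τ ^ 2) := mul_nonneg hK.le (by nlinarith)
  have hξΩ : ξ ∈ Ω := by
    by_contra hn
    have : u ξ = 0 := hb ξ ⟨hξ, by rwa [hΩ.interior_eq]⟩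
    linarith
  have hτlt : τ < m / 4 := by
    refine lt_of_le_of_ne hξτ fun he => ?_
    have := hB ξ hξ
    rw [hφ, he] at hpos
    nlinarith
  have hloc : ∀ᶠ x in 𝓝 ξ, u x ≤ u ξ + (radialBarrier K m R c x - radialBarrier K m R c ξ) := by
    have h1 : ∀ᶠ x in 𝓝 ξ, ‖x - c‖ ^ 2 - R ^ 2 < m / 4 :=
      (Continuous.tendsto (by fun_prop) ξ).eventually (gt_mem_nhds hτlt)
    filter_upwards [h1, hΩ.mem_nhds hξΩ] with x h2 h3
    have : u x - radialBarrier K m R c x ≤ u ξ - radialBarrier K m R c ξ :=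
      hmax ⟨subset_closure h3, h2.le⟩
    linarith
  have hjet := isSuperjet_of_sub_radialBarrier hK.le hloc
  rw [← hτ] at hjet
  obtain ⟨h1, h2⟩ := hlt ξ hξ τ hτ0 hτlt.le
  have hsub := hs.le_of_isSuperjet hΩ hF₂ hu hξΩ h1 (radialHessian_symm _ _ _) hjet
  linarith [hC ξ hξΩ]

theorem boundary_linear_bound (hα : -1 < α) (ha : 0 < a) (haA : a ≤ A)
    (hF₁ : HomogeneousElliptic α F) (hF₂ : WeightedUniformlyElliptic α a A F)
    (hΩ : IsBoundedC2Domain Ω) (hf : ∃ C : ℝ, ∀ x ∈ Ω, |f x| ≤ C)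
    (hu : ContinuousOn u (closure Ω)) (hs : IsViscositySubSol F Ω (fun x _ => f x) u)
    (hb : ∀ x ∈ frontier Ω, u x = 0) :
    ∃ L, 0 ≤ L ∧ ∀ z ∈ frontier Ω, ∀ x ∈ closure Ω, u x ≤ L * ‖x - z‖ := by
  obtain ⟨R, hR, hext⟩ := hΩ.exists_uniform_exterior_ball
  obtain ⟨C, hC⟩ := hf
  obtain ⟨B₀, hB₀⟩ := hs.1
  obtain ⟨D, hD⟩ := (hΩ.2.1.closure).exists_norm_le
  set V := R + 2 * |D| with hV
  have hV0 : 0 < V := by positivity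
  have hVb : ∀ z ∈ frontier Ω, ∀ x ∈ closure Ω, ‖x - z‖ ≤ 2 * |D| := fun z hz x hx => by
    have h1 := hD x hx
    have h2 := hD z (frontier_subset_closure hz)
    have := norm_sub_le x z
    linarith [le_abs_self D]
  set B := |B₀| + 1 with hB
  have hB1 : ∀ x ∈ closure Ω, u x ≤ B := fun x hx => by
    have h1 := hB₀ x hx
    have := le_abs_self (u x)
    have := le_abs_self B₀
    linarith
  have hA : 0 < A := ha.trans_le haA
  set m := a * R ^ 2 / (A * n + 1) with hm
  have hm0 : 0 < m := by positivity
  have hm1 : A * n * m ≤ a * R ^ 2 := by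
    rw [hm, ← mul_div_assoc, div_le_iff₀ (by positivity)]
    nlinarith [mul_pos ha (pow_pos hR 2), mul_nonneg hA.le (Nat.cast_nonneg (α := ℝ) n)]
  obtain ⟨K, hK1, hK2, hK0⟩ : ∃ K : ℝ, B ≤ K * (3 * m ^ 2 / 16) ∧
      |C| < 6 * a * R ^ 2 * ((K * m * R) ^ (1 + α) / (2 * m * V)) ∧ 0 < K := by
    have t1 : Tendsto (fun K : ℝ => K * (3 * m ^ 2 / 16)) atTop atTop :=
      tendsto_id.atTop_mul_const (by positivity)
    have t2 : Tendsto (fun K : ℝ => 6 * a * R ^ 2 * ((K * m * R) ^ (1 + α) / (2 * m * V)))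
        atTop atTop := by
      refine Tendsto.const_mul_atTop (by positivity) (Tendsto.atTop_div_const (by positivity) ?_)
      refine (tendsto_rpow_atTop (by linarith)).comp ?_
      exact (tendsto_id.atTop_mul_const hm0).atTop_mul_const hR
    obtain ⟨K, h⟩ := ((t1.eventually_ge_atTop B).and
      ((t2.eventually_gt_atTop |C|).and (eventually_gt_atTop 0))).exists
    exact ⟨K, h.1, h.2.1, h.2.2⟩
  have hcompΩ : IsCompact (closure Ω) :=
    Metric.isCompact_of_isClosed_isBounded isClosed_closure hΩ.2.1.closure
  refine ⟨(K * m + 4 * B / m) * (2 * |D| + 2 * R), by positivity, fun z hz x hx => ?_⟩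
  obtain ⟨c, hzc, hc⟩ := hext z hz
  have hnear : ∀ x ∈ closure Ω, ‖x - c‖ ^ 2 - R ^ 2 ≤ m / 4 → u x ≤ radialBarrier K m R c x := by
    refine le_radialBarrier hΩ.1 hcompΩ hF₂ hu hs hb hR hm0 hK0 (C := |C|) (fun x hx => ?_) hB1 hK1 hc
      fun x hx τ h0 h1 => apply_radialBarrier_lt hα ha hA hF₁ hF₂ hR hV0 hm0 hm1 hK0 hK2 (hc x hx)
        ?_ h0 h1
    · linarith [(abs_le.1 (hC x hx)).1, le_abs_self C]
    · have h1 := norm_add_le (x - z) (z - c)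
      rw [sub_add_sub_cancel, hzc] at h1
      linarith [hVb z hz x hx]
  have hτle : ‖x - c‖ ^ 2 - R ^ 2 ≤ (2 * |D| + 2 * R) * ‖x - z‖ := by
    have h1 := norm_add_le (x - z) (z - c)
    rw [sub_add_sub_cancel, hzc] at h1
    have h2 := hVb z hz x hx
    nlinarith [norm_nonneg (x - z), norm_nonneg (x - c)]
  have hτ0 : 0 ≤ ‖x - c‖ ^ 2 - R ^ 2 := by nlinarith [hc x hx]
  -- In the shell the barrier is at most `K m τ`; beyond it `τ ≥ m / 4` and the bound B on u
  -- suffices.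
  have hmain : u x ≤ (K * m + 4 * B / m) * (‖x - c‖ ^ 2 - R ^ 2) := by
    rcases le_total (‖x - c‖ ^ 2 - R ^ 2) (m / 4) with h | h
    · refine (hnear x hx h).trans ?_
      simp only [radialBarrier]
      set τ := ‖x - c‖ ^ 2 - R ^ 2
      have : 0 ≤ 4 * B / m * τ := by positivity
      nlinarith [mul_nonneg hK0.le (sq_nonneg τ)]
    · refine (hB1 x hx).trans ?_
      set τ := ‖x - c‖ ^ 2 - R ^ 2
      have h1 : B = 4 * B / m * (m / 4) := by field_simp
      have h2 : 4 * B / m * (m / 4) ≤ 4 * B / m * τ := by gcongr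
      have h3 : 0 ≤ K * m * τ := by positivity
      linarith
  calc u x ≤ _ := hmain
    _ ≤ (K * m + 4 * B / m) * ((2 * |D| + 2 * R) * ‖x - z‖) := by gcongr
    _ = _ := by ring

end barrier

/-! ### The concave modulus of continuity -/

section concaveCone
variable {E : Type*} [NormedAddCommGroup E]

/-- The concave modulus `L (r - κ r ^ 2)` of the norm. -/
def concaveCone (L κ : ℝ) (z : E) : ℝ := L * (‖z‖ - κ * ‖z‖ ^ 2)

theorem continuous_concaveCone (L κ : ℝ) : Continuous (concaveCone L κ : E → ℝ) := by
  unfold concaveCone; fun_prop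

theorem concaveCone_nonneg {L κ : ℝ} (hL : 0 ≤ L) {z : E} (hz : κ * ‖z‖ ≤ 1 / 4) :
    0 ≤ concaveCone L κ z :=
  mul_nonneg hL (by nlinarith [norm_nonneg z])

theorem concaveCone_sub_le {L κ ρ : ℝ} (hL : 0 ≤ L) (hκ : 0 ≤ κ) (hρ : κ * ρ ≤ 1 / 4) {z w : E}
    (hz : ‖z‖ ≤ ρ) (hw : ‖w‖ ≤ ρ) : concaveCone L κ z - concaveCone L κ w ≤ L * ‖z - w‖ := by
  have h1 : concaveCone L κ z - concaveCone L κ w =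
      L * ((‖z‖ - ‖w‖) * (1 - κ * (‖z‖ + ‖w‖))) := by unfold concaveCone; ring
  rw [h1]
  refine mul_le_mul_of_nonneg_left ?_ hL
  have h2 := norm_sub_norm_le z w
  have h3 : 0 ≤ κ * (‖z‖ + ‖w‖) := by positivity
  have h4 : κ * (‖z‖ + ‖w‖) ≤ 1 := by nlinarith
  nlinarith [norm_nonneg (z - w), mul_le_mul_of_nonneg_right h2 (sub_nonneg.2 h4)]

variable [InnerProductSpace ℝ E]

/-- The gradient of `concaveCone`. -/
noncomputable def concaveConeGrad (L κ : ℝ) (z : E) : E := (L * (1 / ‖z‖ - 2 * κ)) • z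

/-- The norm is semiconcave away from 0 (AM–GM), and the term `-κ ‖·‖²` only helps. The constant `L
/ (2 ‖z‖)` is what the regularization scale must exceed. -/
theorem concaveCone_add_le {L κ : ℝ} (hL : 0 ≤ L) (hκ : 0 ≤ κ) {z : E} (hz : z ≠ 0) (h : E) :
    concaveCone L κ (z + h) ≤
      concaveCone L κ z + ⟪concaveConeGrad L κ z, h⟫ + L / (2 * ‖z‖) * ‖h‖ ^ 2 := by
  have hz0 : 0 < ‖z‖ := norm_pos_iff.2 hz
  have e := norm_add_sq_real z h
  have h1 : ‖z + h‖ ≤ ‖z‖ + ⟪z, h⟫ / ‖z‖ + ‖h‖ ^ 2 / (2 * ‖z‖) := by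
    have : ‖z‖ + ⟪z, h⟫ / ‖z‖ + ‖h‖ ^ 2 / (2 * ‖z‖) =
        (‖z‖ ^ 2 + ‖z + h‖ ^ 2) / (2 * ‖z‖) := by
      rw [e]; field_simp; ring
    rw [this, le_div_iff₀ (by positivity)]
    nlinarith [sq_nonneg (‖z‖ - ‖z + h‖)]
  have h2 : ⟪concaveConeGrad L κ z, h⟫ = L * (⟪z, h⟫ / ‖z‖ - 2 * κ * ⟪z, h⟫) := by
    rw [concaveConeGrad, inner_smul_left, conj_trivial]; ring
  have h3 : L / (2 * ‖z‖) * ‖h‖ ^ 2 = L * (‖h‖ ^ 2 / (2 * ‖z‖)) := by ring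
  rw [h2, h3]
  unfold concaveCone
  rw [e, ← mul_add, ← mul_add]
  refine mul_le_mul_of_nonneg_left ?_ hL
  nlinarith [mul_nonneg hκ (sq_nonneg ‖h‖)]

theorem norm_concaveConeGrad {L κ : ℝ} (hL : 0 ≤ L) {z : E} (hz : z ≠ 0) (hκz : κ * ‖z‖ ≤ 1 / 4) :
    ‖concaveConeGrad L κ z‖ = L * (1 - 2 * κ * ‖z‖) := by
  have hz0 : 0 < ‖z‖ := norm_pos_iff.2 hz
  have e : L * (1 / ‖z‖ - 2 * κ) * ‖z‖ = L * (1 - 2 * κ * ‖z‖) := by field_simp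
  have h : 0 ≤ 1 / ‖z‖ - 2 * κ := by
    rw [sub_nonneg, le_div_iff₀ hz0]; linarith
  rw [concaveConeGrad, norm_smul, Real.norm_of_nonneg (mul_nonneg hL h), e]

theorem norm_concaveConeGrad_mem {L κ : ℝ} (hL : 0 ≤ L) (hκ : 0 ≤ κ) {z : E} (hz : z ≠ 0)
    (hκz : κ * ‖z‖ ≤ 1 / 4) : L / 2 ≤ ‖concaveConeGrad L κ z‖ ∧ ‖concaveConeGrad L κ z‖ ≤ L := by
  rw [norm_concaveConeGrad hL hz hκz]
  have := mul_nonneg hκ (norm_nonneg z)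
  constructor <;> nlinarith

theorem exists_lipschitzOnWith_concaveConeGrad (L κ : ℝ) {r : ℝ} (hr : 0 < r) :
    ∃ C, LipschitzOnWith C (concaveConeGrad L κ : E → E) {z | r ≤ ‖z‖} := by
  refine ⟨Real.toNNReal (|L| * (2 / r + 2 * |κ|)), LipschitzOnWith.of_dist_le' fun x hx y hy => ?_⟩
  rw [dist_eq_norm, dist_eq_norm]
  have hx0 : 0 < ‖x‖ := hr.trans_le hx
  have hy0 : 0 < ‖y‖ := hr.trans_le hy
  have e : concaveConeGrad L κ x - concaveConeGrad L κ y =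
      L • ((1 / ‖x‖) • (x - y) + (1 / ‖x‖ - 1 / ‖y‖) • y - (2 * κ) • (x - y)) := by
    unfold concaveConeGrad; module
  have h1 : ‖(1 / ‖x‖) • (x - y)‖ ≤ 1 / r * ‖x - y‖ := by
    rw [norm_smul, norm_div, norm_one, norm_norm]
    gcongr; exact hx
  have h2 : ‖(1 / ‖x‖ - 1 / ‖y‖) • y‖ ≤ 1 / r * ‖x - y‖ := by
    have : 1 / ‖x‖ - 1 / ‖y‖ = (‖y‖ - ‖x‖) / (‖x‖ * ‖y‖) := by field_simp
    rw [norm_smul, this, norm_div, Real.norm_eq_abs, norm_mul, norm_norm, norm_norm]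
    have h3 : |‖y‖ - ‖x‖| / (‖x‖ * ‖y‖) * ‖y‖ = 1 / ‖x‖ * |‖y‖ - ‖x‖| := by field_simp
    rw [h3, norm_sub_rev x y]
    have h4 := abs_norm_sub_norm_le y x
    have h5 : 1 / ‖x‖ ≤ 1 / r := one_div_le_one_div_of_le hr hx
    gcongr
  have h3 : ‖(2 * κ) • (x - y)‖ = 2 * |κ| * ‖x - y‖ := by
    rw [norm_smul, norm_mul, Real.norm_eq_abs, Real.norm_eq_abs, abs_two]
  rw [e, norm_smul, Real.norm_eq_abs, mul_assoc]
  refine mul_le_mul_of_nonneg_left ?_ (abs_nonneg L)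
  have h4 := norm_sub_le ((1 / ‖x‖) • (x - y) + (1 / ‖x‖ - 1 / ‖y‖) • y) ((2 * κ) • (x - y))
  have h5 := norm_add_le ((1 / ‖x‖) • (x - y)) ((1 / ‖x‖ - 1 / ‖y‖) • y)
  have h6 : (2 / r + 2 * |κ|) * ‖x - y‖ =
    1 / r * ‖x - y‖ + 1 / r * ‖x - y‖ + 2 * |κ| * ‖x - y‖ := by ring
  linarith

end concaveCone

/-! ### Optimality conditions for the doubled function -/

section maximum
variable {E : Type*} [NormedAddCommGroup E] [InnerProductSpace ℝ E]
  {v₁ v₂ : E → ℝ} {g₁ g₂ : E → E} {L κ C : ℝ} {x y p₁ p₂ : E}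

/-- First-order conditions at a local maximum of the doubled function. -/
theorem gradient_eq_of_isLocalMax (hL : 0 ≤ L) (hκ : 0 ≤ κ)
    (h₁ : ∀ x k, |v₁ (x + k) - v₁ x - ⟪g₁ x, k⟫| ≤ C * ‖k‖ ^ 2)
    (h₂ : ∀ x k, |v₂ (x + k) - v₂ x - ⟪g₂ x, k⟫| ≤ C * ‖k‖ ^ 2) (hxy : x - y ≠ 0)
    (hmax : ∀ᶠ w : E × E in 𝓝 0,
      v₁ (x + w.1) + v₂ (y + w.2) - concaveCone L κ (x + w.1 - (y + w.2)) - ⟪p₁, w.1⟫ - ⟪p₂, w.2⟫ ≤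
        v₁ x + v₂ y - concaveCone L κ (x - y)) :
    (g₁ x = concaveConeGrad L κ (x - y) + p₁ ∧
      ∀ᶠ k in 𝓝 0, v₁ (x + k) ≤ v₁ x + ⟪g₁ x, k⟫ + L / (2 * ‖x - y‖) * ‖k‖ ^ 2) ∧
    (g₂ y = -concaveConeGrad L κ (x - y) + p₂ ∧
      ∀ᶠ k in 𝓝 0, v₂ (y + k) ≤ v₂ y + ⟪g₂ y, k⟫ + L / (2 * ‖x - y‖) * ‖k‖ ^ 2) := by
  constructor
  · have t : Tendsto (fun k : E => (k, (0 : E))) (𝓝 0) (𝓝 0) :=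
      Continuous.tendsto' (by fun_prop) 0 0 rfl
    have hup : ∀ᶠ k in 𝓝 (0 : E), v₁ (x + k) ≤
        v₁ x + ⟪concaveConeGrad L κ (x - y) + p₁, k⟫ + L / (2 * ‖x - y‖) * ‖k‖ ^ 2 := by
      filter_upwards [t.eventually hmax] with k hk
      have := concaveCone_add_le hL hκ hxy k
      simp only [add_zero, inner_zero_right, sub_zero] at hk
      rw [show x + k - y = x - y + k by abel] at hk
      rw [inner_add_left]
      linarith
    have he : g₁ x = concaveConeGrad L κ (x - y) + p₁ := by
      refine sub_eq_zero.1 (eq_zero_of_inner_le_sq (C := C + L / (2 * ‖x - y‖)) ?_)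
      filter_upwards [hup] with k hk
      have := (abs_le.1 (h₁ x k)).1
      rw [inner_sub_left]
      linarith
    exact ⟨he, by rwa [he]⟩
  · have t : Tendsto (fun k : E => ((0 : E), k)) (𝓝 0) (𝓝 0) :=
      Continuous.tendsto' (by fun_prop) 0 0 rfl
    have hup : ∀ᶠ k in 𝓝 (0 : E), v₂ (y + k) ≤
        v₂ y + ⟪-concaveConeGrad L κ (x - y) + p₂, k⟫ + L / (2 * ‖x - y‖) * ‖k‖ ^ 2 := by
      filter_upwards [t.eventually hmax] with k hk
      have := concaveCone_add_le hL hκ hxy (-k)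
      simp only [add_zero, inner_zero_right, sub_zero] at hk
      rw [show x - (y + k) = x - y + -k by abel] at hk
      rw [inner_neg_right, norm_neg] at this
      rw [inner_add_left, inner_neg_left]
      linarith
    have he : g₂ y = -concaveConeGrad L κ (x - y) + p₂ := by
      refine sub_eq_zero.1 (eq_zero_of_inner_le_sq (C := C + L / (2 * ‖x - y‖)) ?_)
      filter_upwards [hup] with k hk
      have := (abs_le.1 (h₂ y k)).1
      rw [inner_sub_left]
      linarith
    exact ⟨he, by rwa [he]⟩

theorem tendsto_smul_nhdsGT_zero (k : E) : Tendsto (fun τ : ℝ => τ • k) (𝓝[>] 0) (𝓝 0) :=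
  (Continuous.tendsto' (by fun_prop) 0 0 (zero_smul ℝ k)).mono_left nhdsWithin_le_nhds

/-- Second-order conditions at a local maximum of the doubled function. -/
theorem hessian_le_of_isLocalMax {T₁ T₂ : E →L[ℝ] E}
    (h₁ : ∀ ε > 0, ∀ᶠ k in 𝓝 (0 : E),
      |v₁ (x + k) - v₁ x - ⟪g₁ x, k⟫ - ⟪T₁ k, k⟫ / 2| ≤ ε * ‖k‖ ^ 2)
    (h₂ : ∀ ε > 0, ∀ᶠ k in 𝓝 (0 : E),
      |v₂ (y + k) - v₂ y - ⟪g₂ y, k⟫ - ⟪T₂ k, k⟫ / 2| ≤ ε * ‖k‖ ^ 2) (hxy : x - y ≠ 0)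
    (hg₁ : g₁ x = concaveConeGrad L κ (x - y) + p₁)
    (hg₂ : g₂ y = -concaveConeGrad L κ (x - y) + p₂)
    (hmax : ∀ᶠ w : E × E in 𝓝 0,
      v₁ (x + w.1) + v₂ (y + w.2) - concaveCone L κ (x + w.1 - (y + w.2)) - ⟪p₁, w.1⟫ - ⟪p₂, w.2⟫ ≤
        v₁ x + v₂ y - concaveCone L κ (x - y)) :
    (∀ k, ⟪(T₁ + T₂) k, k⟫ ≤ 0) ∧ ∃ e : E, ‖e‖ = 1 ∧ ⟪(T₁ + T₂) e, e⟫ ≤ -(8 * L * κ) := by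
  have quad : ∀ (T : E →L[ℝ] E) (τ : ℝ) (k : E), ⟪T (τ • k), τ • k⟫ = τ ^ 2 * ⟪T k, k⟫ := by
    intro T τ k
    rw [map_smul, inner_smul_left, inner_smul_right, conj_trivial]; ring
  have nsq : ∀ (τ : ℝ) (k : E), ‖τ • k‖ ^ 2 = τ ^ 2 * ‖k‖ ^ 2 := by
    intro τ k
    rw [norm_smul, mul_pow, Real.norm_eq_abs, sq_abs]
  constructor
  · intro k
    refine le_of_forall_le_add_mul (c := ‖k‖ ^ 2) fun ε hε => ?_
    -- Moving both points by the same vector leaves `x - y`, hence the modulus, unchanged.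
    have t : Tendsto (fun τ : ℝ => (τ • k, τ • k)) (𝓝[>] 0) (𝓝 0) :=
      (tendsto_smul_nhdsGT_zero k).prodMk_nhds (tendsto_smul_nhdsGT_zero k)
    have t1 := tendsto_smul_nhdsGT_zero k
    obtain ⟨τ, ⟨a1, a2⟩, ⟨a3, a4⟩⟩ := (((t1.eventually (h₁ (ε / 4) (by positivity))).and
      (t1.eventually (h₂ (ε / 4) (by positivity)))).and
      ((t.eventually hmax).and self_mem_nhdsWithin)).exists
    have b1 := (abs_le.1 a1).1
    have b2 := (abs_le.1 a2).1
    rw [hg₁, inner_add_left, quad, nsq] at b1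
    rw [hg₂, inner_add_left, inner_neg_left, quad, nsq] at b2
    rw [add_sub_add_right_eq_sub] at a3
    have hτ : 0 < τ := a4
    have h3 : τ ^ 2 * (⟪T₁ k, k⟫ + ⟪T₂ k, k⟫) ≤ τ ^ 2 * (0 + ε * ‖k‖ ^ 2) := by linarith
    rw [add_apply, inner_add_left]
    exact le_of_mul_le_mul_left h3 (by positivity)
  · have hr : 0 < ‖x - y‖ := norm_pos_iff.2 hxy
    set e : E := (1 / ‖x - y‖) • (x - y) with he
    have ne : ‖e‖ = 1 := by
      rw [he, norm_smul, norm_div, norm_one, norm_norm, one_div_mul_cancel hr.ne']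
    have hxe : x - y = ‖x - y‖ • e := by
      rw [he, smul_smul, mul_one_div_cancel hr.ne', one_smul]
    have hge : ⟪concaveConeGrad L κ (x - y), e⟫ = L * (1 - 2 * κ * ‖x - y‖) := by
      rw [concaveConeGrad, he, inner_smul_left, inner_smul_right, conj_trivial,
        real_inner_self_eq_norm_sq]
      field_simp
    -- Moving the points apart by `τ e` and `-τ e` lengthens `x - y` to `‖x - y‖ + 2 τ`. The
    -- second-order part of the modulus is then exactly `-4 L κ τ²`, half of the stated bound.
    refine ⟨e, ne, le_of_forall_le_add_mul (c := 1) fun ε hε => ?_⟩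
    have t1 := tendsto_smul_nhdsGT_zero e
    have t2 := tendsto_smul_nhdsGT_zero (-e)
    obtain ⟨τ, ⟨a1, a2⟩, ⟨a3, a4⟩⟩ := (((t1.eventually (h₁ (ε / 4) (by positivity))).and
      (t2.eventually (h₂ (ε / 4) (by positivity)))).and
      (((t1.prodMk_nhds t2).eventually hmax).and self_mem_nhdsWithin)).exists
    have hτ : 0 < τ := a4
    have b1 := (abs_le.1 a1).1
    have b2 := (abs_le.1 a2).1
    rw [hg₁, inner_add_left, quad, nsq, inner_smul_right, hge, ne] at b1
    rw [hg₂, inner_add_left, inner_neg_left, quad, nsq, inner_smul_right, inner_neg_right, hge,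
      map_neg, inner_neg_neg, norm_neg, ne] at b2
    have hn : ‖x + τ • e - (y + τ • (-e))‖ = ‖x - y‖ + 2 * τ := by
      have : x + τ • e - (y + τ • (-e)) = (‖x - y‖ + 2 * τ) • e := by
        calc x + τ • e - (y + τ • (-e)) = (x - y) + (2 * τ) • e := by module
          _ = _ := by rw [add_smul, ← hxe]
      rw [this, norm_smul, ne, mul_one, Real.norm_of_nonneg (by positivity)]
    simp only [concaveCone, hn, inner_smul_right, inner_neg_right] at a3 b2
    rw [inner_smul_right] at b1
    have h3 : τ ^ 2 * (⟪T₁ e, e⟫ + ⟪T₂ e, e⟫) ≤ τ ^ 2 * (-(8 * L * κ) + ε * 1) := by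
      nlinarith
    rw [add_apply, inner_add_left]
    exact le_of_mul_le_mul_left h3 (by positivity)

end maximum

/-! ### Doubling of variables -/

section doubling
variable {E : Type*} [NormedAddCommGroup E]

/-- Points realizing almost the maximum of the penalized doubled function are close to the
points they come from. -/
theorem norm_add_norm_le_of_penalized {K : Set E} {u : E → ℝ} {L κ M σ η₀ c ρ : ℝ} {x y ξ η : E}
    (hL : 0 < L) (hκ : 0 ≤ κ) (hκρ : κ * (2 * ρ) ≤ 1 / 4)
    (hM : ∀ x ∈ K, ∀ y ∈ K, u x - u y - concaveCone L κ (x - y) ≤ M)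
    (hσ : 0 ≤ σ) (hη₀ : 0 < η₀) (hc : 2 * (σ / η₀ + L) < c * η₀)
    (hx : ‖x‖ ≤ ρ) (hy : ‖y‖ ≤ ρ) (hξρ : ‖ξ‖ ≤ ρ) (hηρ : ‖η‖ ≤ ρ) (hξ : ξ ∈ K) (hη : η ∈ K)
    (h : M - σ ≤ (u ξ - c * ‖x - ξ‖ ^ 2) + (-u η - c * ‖y - η‖ ^ 2) - concaveCone L κ (x - y)) :
    ‖x - ξ‖ + ‖y - η‖ ≤ η₀ ∧
      M - σ - L * (‖x - ξ‖ + ‖y - η‖) ≤ u ξ - u η - concaveCone L κ (ξ - η) := by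
  have hc0 : 0 < c := by
    by_contra! hle
    have : 0 ≤ σ / η₀ := by positivity
    nlinarith
  have h1 : concaveCone L κ (ξ - η) - concaveCone L κ (x - y) ≤ L * ‖ξ - η - (x - y)‖ := by
    refine concaveCone_sub_le hL.le hκ hκρ ?_ ?_
    · exact (norm_sub_le _ _).trans (by linarith)
    · exact (norm_sub_le _ _).trans (by linarith)
  have h2 : ‖ξ - η - (x - y)‖ ≤ ‖x - ξ‖ + ‖y - η‖ := by
    rw [show ξ - η - (x - y) = (y - η) - (x - ξ) by abel, add_comm]
    exact norm_sub_le _ _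
  have h3 := mul_le_mul_of_nonneg_left h2 hL.le
  have h4 := hM ξ hξ η hη
  set d₁ := ‖x - ξ‖
  set d₂ := ‖y - η‖
  have hd₁ : 0 ≤ d₁ := norm_nonneg _
  have hd₂ : 0 ≤ d₂ := norm_nonneg _
  have h5 : 0 ≤ c * d₁ ^ 2 := by positivity
  have h6 : 0 ≤ c * d₂ ^ 2 := by positivity
  refine ⟨?_, by linarith⟩
  by_contra! hlt
  set s := d₁ + d₂ with hs
  have hs0 : 0 < s := hη₀.trans hlt
  have h7 : c * s ^ 2 ≤ 2 * (c * d₁ ^ 2 + c * d₂ ^ 2) := by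
    rw [hs]; nlinarith [mul_nonneg hc0.le (sq_nonneg (d₁ - d₂))]
  have h8 : σ ≤ σ / η₀ * s := by
    rw [div_mul_eq_mul_div, le_div_iff₀ hη₀]
    exact mul_le_mul_of_nonneg_left hlt.le hσ
  have h9 : 2 * (σ / η₀ + L) * s < c * η₀ * s := mul_lt_mul_of_pos_right hc hs0
  have h10 : c * η₀ * s ≤ c * s * s := by gcongr
  nlinarith

variable [InnerProductSpace ℝ E]

/-- Translating by `x - ξ` keeps the penalty constant, so the expansion of v at x bounds u near ξ.
-/
theorem isSuperjet_of_contact {K : Set E} {u v : E → ℝ} {c : ℝ} {x ξ p : E} {T : E →L[ℝ] E}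
    (hK : K ∈ 𝓝 ξ) (hlow : ∀ x, ∀ ξ ∈ K, u ξ - c * ‖x - ξ‖ ^ 2 ≤ v x)
    (heq : v x = u ξ - c * ‖x - ξ‖ ^ 2)
    (hT : ∀ ε > 0, ∀ᶠ k in 𝓝 (0 : E),
      |v (x + k) - v x - ⟪p, k⟫ - ⟪T k, k⟫ / 2| ≤ ε * ‖k‖ ^ 2) :
    IsSuperjet u ξ p T := by
  intro ε hε
  have t : Tendsto (fun x' => x' - ξ) (𝓝 ξ) (𝓝 0) :=
    Continuous.tendsto' (by fun_prop) ξ 0 (sub_self ξ)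
  filter_upwards [t.eventually (hT ε hε), hK] with x' h1 h2
  have h3 := hlow (x + (x' - ξ)) x' h2
  rw [show x + (x' - ξ) - x' = x - ξ by abel] at h3
  have h4 := (abs_le.1 h1).2
  linarith

set_option maxHeartbeats 1000000 in
/-- Doubling of variables: jets at an interior positive maximum of `u x - u y - ψ (x - y)`. -/
theorem exists_superjets_of_doubling [FiniteDimensional ℝ E] {K Ω : Set E} {u : E → ℝ}
    {L κ D : ℝ} (hK : IsCompact K) (hΩ : IsOpen Ω) (hΩK : Ω ⊆ K) (hu : ContinuousOn u K)
    (hL : 0 < L) (hκ : 0 ≤ κ) (hKD : ∀ x ∈ K, ‖x‖ ≤ D) (hκD : κ * (2 * (D + 1)) ≤ 1 / 4)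
    (hpos : ∃ x ∈ K, ∃ y ∈ K, 0 < u x - u y - concaveCone L κ (x - y))
    (hint : ∀ x ∈ K, ∀ y ∈ K, 0 < u x - u y - concaveCone L κ (x - y) → x ∈ Ω ∧ y ∈ Ω) :
    ∃ N : ℝ, ∀ θ > 0, ∃ ξ ∈ Ω, ∃ η ∈ Ω, ∃ (p q e : E) (T₁ T₂ : E →L[ℝ] E),
      ((∀ a b, ⟪T₁ a, b⟫ = ⟪a, T₁ b⟫) ∧ (∀ a b, ⟪T₂ a, b⟫ = ⟪a, T₂ b⟫)) ∧
      (‖T₁‖ ≤ N ∧ ‖T₂‖ ≤ N) ∧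
      (IsSuperjet u ξ p T₁ ∧ IsSuperjet (fun x => -u x) η q T₂) ∧
      (‖p + q‖ ≤ θ ∧ L / 2 - θ ≤ ‖p‖ ∧ ‖p‖ ≤ L + θ ∧ L / 2 - θ ≤ ‖q‖ ∧ ‖q‖ ≤ L + θ) ∧
      (∀ k, ⟪(T₁ + T₂) k, k⟫ ≤ 0) ∧ ‖e‖ = 1 ∧ ⟪(T₁ + T₂) e, e⟫ ≤ -(8 * L * κ) := by
  have : ProperSpace E := FiniteDimensional.proper ℝ E
  obtain ⟨x₁, hx₁, y₁, hy₁, hpos₁⟩ := hpos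
  have hne : K.Nonempty := ⟨x₁, hx₁⟩
  have hD0 : 0 ≤ D := (norm_nonneg _).trans (hKD x₁ hx₁)
  obtain ⟨⟨xs, ys⟩, ⟨hxs, hys⟩, hmaxM⟩ := (hK.prod hK).exists_isMaxOn ⟨(x₁, y₁), hx₁, hy₁⟩
    (f := fun w : E × E => u w.1 - u w.2 - concaveCone L κ (w.1 - w.2))
    (((hu.comp continuousOn_fst fun w hw => hw.1).sub
      (hu.comp continuousOn_snd fun w hw => hw.2)).sub
      ((continuous_concaveCone L κ).comp (continuous_fst.sub continuous_snd)).continuousOn)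
  obtain ⟨M, hMdef⟩ : ∃ M, M = u xs - u ys - concaveCone L κ (xs - ys) := ⟨_, rfl⟩
  have hM : ∀ x ∈ K, ∀ y ∈ K, u x - u y - concaveCone L κ (x - y) ≤ M := fun x hx y hy => by
    rw [hMdef]; exact hmaxM (a := (x, y)) ⟨hx, hy⟩
  have hM0 : 0 < M := hpos₁.trans_le (hM x₁ hx₁ y₁ hy₁)
  obtain ⟨r₂, hr₂, hunif⟩ := Metric.uniformContinuousOn_iff.1
    (hK.uniformContinuousOn_of_continuous hu) (M / 2) (by positivity)
  have hfar : ∀ x ∈ K, ∀ y ∈ K, M / 2 ≤ u x - u y - concaveCone L κ (x - y) → r₂ ≤ ‖x - y‖ := by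
    intro x hx y hy h
    by_contra! hlt
    rw [← dist_eq_norm] at hlt
    have h1 := hunif x hx y hy hlt
    rw [Real.dist_eq] at h1
    have h2 : 0 ≤ concaveCone L κ (x - y) := by
      refine concaveCone_nonneg hL.le (le_trans ?_ hκD)
      refine mul_le_mul_of_nonneg_left ((norm_sub_le x y).trans ?_) hκ
      linarith [hKD x hx, hKD y hy]
    linarith [(abs_lt.1 h1).2]
  -- The three bounds keep the perturbed maxima inside the ball of radius `D + 1`, limit the loss in
  -- value to `M / 4`, and keep x and y at least `r₂ / 2` apart.
  obtain ⟨η₀, hη₀, hη1, hη2, hη3⟩ : ∃ η₀ : ℝ, 0 < η₀ ∧ η₀ ≤ 1 / 2 ∧ L * η₀ ≤ M / 4 ∧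
      η₀ ≤ r₂ / 2 := by
    refine ⟨min (1 / 2) (min (M / (4 * L)) (r₂ / 2)), by positivity, min_le_left _ _, ?_,
      (min_le_right _ _).trans (min_le_right _ _)⟩
    have h : min (1 / 2) (min (M / (4 * L)) (r₂ / 2)) ≤ M / (4 * L) :=
      (min_le_right _ _).trans (min_le_left _ _)
    rw [le_div_iff₀ (by positivity)] at h
    linarith
  -- The first bound forces almost-maximizers to be `η₀`-close to their base points; the second puts
  -- `2 c` above the Hessian bound of the modulus.
  obtain ⟨c, hc0, hc1, hc2⟩ : ∃ c : ℝ, 0 < c ∧ 2 * (M / 4 / η₀ + L) < c * η₀ ∧ L / r₂ < 2 * c := by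
    have t1 : Tendsto (fun c : ℝ => c * η₀) atTop atTop := tendsto_id.atTop_mul_const hη₀
    have t2 : Tendsto (fun c : ℝ => 2 * c) atTop atTop :=
      tendsto_id.const_mul_atTop (by norm_num)
    obtain ⟨c, h1, h2, h3⟩ := ((eventually_gt_atTop (0 : ℝ)).and
      ((t1.eventually_gt_atTop (2 * (M / 4 / η₀ + L))).and
      (t2.eventually_gt_atTop (L / r₂)))).exists
    exact ⟨c, h1, h2, h3⟩
  obtain ⟨v₁, g₁, ha₁, hb₁, hc₁, hd₁⟩ := exists_regularization hK hne hu hc0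
  obtain ⟨v₂, g₂, ha₂, hb₂, hc₂, hd₂⟩ := exists_regularization hK hne hu.neg hc0
  have hlip₁ := lipschitzWith_of_abs_sub_inner_le (by positivity) ha₁
  have hlip₂ := lipschitzWith_of_abs_sub_inner_le (by positivity) ha₂
  have hv₁ := hasFDerivAt_of_abs_sub_inner_le ha₁
  have hv₂ := hasFDerivAt_of_abs_sub_inner_le ha₂
  have hcv₁ : Continuous v₁ := continuous_iff_continuousAt.2 fun x => (hv₁ x).continuousAt
  have hcv₂ : Continuous v₂ := continuous_iff_continuousAt.2 fun x => (hv₂ x).continuousAt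
  -- The Hessian bound depends on c alone, fixed before θ; this lets θ later be chosen in terms of
  -- N.
  refine ⟨Real.toNNReal (6 * (2 * c)), fun θ hθ => ?_⟩
  obtain ⟨r, hr, hr1, hr2⟩ : ∃ r : ℝ, 0 < r ∧ r * (4 * (D + 1)) ≤ M / 4 ∧ 2 * r ≤ θ := by
    refine ⟨min (M / 4 / (4 * (D + 1))) (θ / 2), by positivity, ?_, ?_⟩
    · rw [← le_div_iff₀ (by positivity)]; exact min_le_left _ _
    · have := min_le_right (M / 4 / (4 * (D + 1))) (θ / 2); linarith
  set H : E × E → E × E → ℝ := fun p w =>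
    v₁ w.1 + v₂ w.2 - concaveCone L κ (w.1 - w.2) - ⟪p.1, w.1⟫ - ⟪p.2, w.2⟫ with hH
  have hHc : ∀ p, Continuous (H p) := fun p => by
    have := (continuous_concaveCone (E := E) L κ).comp (continuous_fst.sub continuous_snd)
    exact (((hcv₁.comp continuous_fst).add (hcv₂.comp continuous_snd)).sub this).sub
      (continuous_const.inner continuous_fst) |>.sub (continuous_const.inner continuous_snd)
  have hBc : IsCompact (Metric.closedBall (0 : E) (D + 1) ×ˢ Metric.closedBall (0 : E) (D + 1)) :=
    (isCompact_closedBall _ _).prod (isCompact_closedBall _ _)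
  have hex : ∀ p, ∃ w ∈ Metric.closedBall (0 : E) (D + 1) ×ˢ Metric.closedBall (0 : E) (D + 1),
      IsMaxOn (H p) (Metric.closedBall (0 : E) (D + 1) ×ˢ Metric.closedBall (0 : E) (D + 1)) w :=
    fun p => hBc.exists_isMaxOn ⟨(0, 0), by simp; positivity, by simp; positivity⟩
      (hHc p).continuousOn
  choose z hzB hzmax using hex
  have hKB : ∀ x ∈ K, x ∈ Metric.closedBall (0 : E) (D + 1) := fun x hx => by
    rw [mem_closedBall_zero_iff]; linarith [hKD x hx]
  have hinn : ∀ (p x : E), ‖p‖ < r → ‖x‖ ≤ D + 1 → |⟪p, x⟫| ≤ r * (D + 1) := fun p x hp hx =>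
    (abs_real_inner_le_norm p x).trans (mul_le_mul hp.le hx (norm_nonneg _) hr.le)
  have hval : ∀ p ∈ Metric.ball (0 : E × E) r,
      M - M / 4 ≤ v₁ (z p).1 + v₂ (z p).2 - concaveCone L κ ((z p).1 - (z p).2) := by
    intro p hp
    rw [mem_ball_zero_iff, Prod.norm_def, max_lt_iff] at hp
    have h1 : H p (xs, ys) ≤ H p (z p) := hzmax p ⟨hKB xs hxs, hKB ys hys⟩
    simp only [hH] at h1
    have h2 := hb₁ xs xs hxs
    have h3 := hb₂ ys ys hys
    rw [sub_self, norm_zero] at h2 h3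
    have h4 := hzB p
    rw [mem_prod, mem_closedBall_zero_iff, mem_closedBall_zero_iff] at h4
    have i1 := abs_le.1 (hinn p.1 xs hp.1 (by linarith [hKD xs hxs]))
    have i2 := abs_le.1 (hinn p.2 ys hp.2 (by linarith [hKD ys hys]))
    have i3 := abs_le.1 (hinn p.1 (z p).1 hp.1 h4.1)
    have i4 := abs_le.1 (hinn p.2 (z p).2 hp.2 h4.2)
    simp only [Pi.neg_apply] at h3
    linarith [i1.2, i2.2, i3.1, i4.1]
  have hpen : ∀ p ∈ Metric.ball (0 : E × E) r, ∀ ξ ∈ K, ∀ η ∈ K,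
      v₁ (z p).1 ≤ u ξ - c * ‖(z p).1 - ξ‖ ^ 2 → v₂ (z p).2 ≤ -u η - c * ‖(z p).2 - η‖ ^ 2 →
      ‖(z p).1 - ξ‖ + ‖(z p).2 - η‖ ≤ η₀ ∧ M / 2 ≤ u ξ - u η - concaveCone L κ (ξ - η) := by
    intro p hp ξ hξ η hη h1 h2
    have h4 := hzB p
    rw [mem_prod, mem_closedBall_zero_iff, mem_closedBall_zero_iff] at h4
    have h5 := norm_add_norm_le_of_penalized (x := (z p).1) (y := (z p).2) hL hκ hκD hM
      (by positivity : 0 ≤ M / 4) hη₀ hc1 h4.1 h4.2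
      (by linarith [hKD ξ hξ]) (by linarith [hKD η hη]) hξ hη (by linarith [hval p hp])
    refine ⟨h5.1, ?_⟩
    have := mul_le_mul_of_nonneg_left h5.1 hL.le
    linarith [h5.2]
  have hloc : ∀ p ∈ Metric.ball (0 : E × E) r,
      ‖(z p).1‖ < D + 1 ∧ ‖(z p).2‖ < D + 1 ∧ r₂ / 2 ≤ ‖(z p).1 - (z p).2‖ := by
    intro p hp
    obtain ⟨ξ, hξ, h1⟩ := hc₁ (z p).1
    obtain ⟨η, hη, h2⟩ := hc₂ (z p).2
    obtain ⟨h3, h4⟩ := hpen p hp ξ hξ η hη h1 h2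
    have h5 := hfar ξ hξ η hη h4
    have n1 := norm_nonneg ((z p).1 - ξ)
    have n2 := norm_nonneg ((z p).2 - η)
    have n3 := norm_add_le ((z p).1 - ξ) ξ
    have n4 := norm_add_le ((z p).2 - η) η
    rw [sub_add_cancel] at n3 n4
    have n5 := norm_add_le (((z p).1 - (z p).2)) (((z p).2 - η) - ((z p).1 - ξ))
    rw [show (z p).1 - (z p).2 + (((z p).2 - η) - ((z p).1 - ξ)) = ξ - η by abel] at n5
    have n6 := norm_sub_le ((z p).2 - η) ((z p).1 - ξ)
    exact ⟨by linarith [hKD ξ hξ], by linarith [hKD η hη], by linarith⟩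
  have hmax : ∀ p ∈ Metric.ball (0 : E × E) r, ∀ᶠ w : E × E in 𝓝 0,
      v₁ ((z p).1 + w.1) + v₂ ((z p).2 + w.2) -
        concaveCone L κ ((z p).1 + w.1 - ((z p).2 + w.2)) - ⟪p.1, w.1⟫ - ⟪p.2, w.2⟫ ≤
        v₁ (z p).1 + v₂ (z p).2 - concaveCone L κ ((z p).1 - (z p).2) := by
    intro p hp
    obtain ⟨h1, h2, -⟩ := hloc p hp
    have e1 : ∀ᶠ w : E × E in 𝓝 0, ‖(z p).1 + w.1‖ < D + 1 :=
      (Continuous.tendsto' (by fun_prop) 0 ‖(z p).1‖ (by simp)).eventually (gt_mem_nhds h1)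
    have e2 : ∀ᶠ w : E × E in 𝓝 0, ‖(z p).2 + w.2‖ < D + 1 :=
      (Continuous.tendsto' (by fun_prop) 0 ‖(z p).2‖ (by simp)).eventually (gt_mem_nhds h2)
    filter_upwards [e1, e2] with w hw1 hw2
    have h3 : H p ((z p).1 + w.1, (z p).2 + w.2) ≤ H p (z p) :=
      hzmax p ⟨mem_closedBall_zero_iff.2 hw1.le, mem_closedBall_zero_iff.2 hw2.le⟩
    simp only [hH, inner_add_right] at h3
    linarith
  have hzne : ∀ p ∈ Metric.ball (0 : E × E) r, (z p).1 - (z p).2 ≠ 0 := fun p hp =>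
    norm_pos_iff.1 ((half_pos hr₂).trans_le (hloc p hp).2.2)
  have hgrad := fun p hp => gradient_eq_of_isLocalMax hL.le hκ ha₁ ha₂ (hzne p hp) (hmax p hp)
  obtain ⟨C₀, hC₀⟩ := exists_lipschitzOnWith_concaveConeGrad (E := E) L κ (half_pos hr₂)
  have hS : LipschitzOnWith (C₀ * (1 + 1)) (fun w : E × E => concaveConeGrad L κ (w.1 - w.2))
      {w : E × E | r₂ / 2 ≤ ‖w.1 - w.2‖} :=
    hC₀.comp (LipschitzWith.prod_fst.sub LipschitzWith.prod_snd).lipschitzOnWith fun w hw => hw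
  have hg₁ : LipschitzWith _ fun w : E × E => g₁ w.1 := hlip₁.comp LipschitzWith.prod_fst
  have hg₂ : LipschitzWith _ fun w : E × E => g₂ w.2 := hlip₂.comp LipschitzWith.prod_snd
  -- This Lipschitz map is the gradient of the unperturbed doubled function; by the first-order
  -- conditions it sends `z p` to p.
  have hG := (hg₁.lipschitzOnWith.sub hS).prodMk (hg₂.lipschitzOnWith.add hS)
  obtain ⟨p, hp, hdiff⟩ := exists_differentiableAt_of_lipschitzOnWith hG (hg₁.prodMk hg₂) hr
    (z := z) fun p hp => by
      refine ⟨(hloc p hp).2.2, ?_⟩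
      have h := hgrad p hp
      rw [h.1.1, h.2.1, add_sub_cancel_left, neg_add_cancel_comm]
  obtain ⟨x, hx⟩ : ∃ x, x = (z p).1 := ⟨_, rfl⟩
  obtain ⟨y, hy⟩ : ∃ y, y = (z p).2 := ⟨_, rfl⟩
  have hzp : z p = (x, y) := by rw [hx, hy]
  have hpenp := hpen p hp
  have hlocp := hloc p hp
  have hmaxp := hmax p hp
  have hgradp := hgrad p hp
  have hnep := hzne p hp
  rw [hzp] at hpenp hlocp hmaxp hgradp hnep hdiff
  simp only at hpenp hlocp hmaxp hgradp hnep
  obtain ⟨⟨hgx, hupx⟩, ⟨hgy, hupy⟩⟩ := hgradp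
  have hd₁x : DifferentiableAt ℝ g₁ x := by
    have h1 : DifferentiableAt ℝ (fun w : E × E => g₁ w.1) (x, y) := hdiff.fst
    exact DifferentiableAt.comp (f := fun x' : E => (x', y)) x h1
      (differentiableAt_id.prodMk (differentiableAt_const y))
  have hd₂y : DifferentiableAt ℝ g₂ y := by
    have h1 : DifferentiableAt ℝ (fun w : E × E => g₂ w.2) (x, y) := hdiff.snd
    exact DifferentiableAt.comp (f := fun y' : E => (x, y')) y h1
      ((differentiableAt_const x).prodMk differentiableAt_id)
  have hb : L / (2 * ‖x - y‖) < 2 * c := by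
    refine lt_of_le_of_lt ?_ hc2
    have : r₂ ≤ 2 * ‖x - y‖ := by linarith [hlocp.2.2]
    gcongr
  obtain ⟨ξ, hξ, hξe⟩ := hd₁ x _ hb hupx
  obtain ⟨η, hη, hηe⟩ := hd₂ y _ hb hupy
  have hΦ := (hpenp ξ hξ η hη (by rw [hξe]; nlinarith [mul_nonneg hc0.le (sq_nonneg ‖x - ξ‖)])
    (by rw [hηe]; simp only [Pi.neg_apply]; nlinarith [mul_nonneg hc0.le (sq_nonneg ‖y - η‖)])).2
  obtain ⟨hξΩ, hηΩ⟩ := hint ξ hξ η hη (by linarith)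
  have ht₁ := fun ε (hε : ε > 0) => taylor_two_of_hasFDerivAt_gradient hv₁ hd₁x.hasFDerivAt hε
  have ht₂ := fun ε (hε : ε > 0) => taylor_two_of_hasFDerivAt_gradient hv₂ hd₂y.hasFDerivAt hε
  obtain ⟨hle, e, he1, he2⟩ := hessian_le_of_isLocalMax ht₁ ht₂ hnep hgx hgy hmaxp
  rw [mem_ball_zero_iff, Prod.norm_def, max_lt_iff] at hp
  have hκn : κ * ‖x - y‖ ≤ 1 / 4 := by
    refine le_trans (mul_le_mul_of_nonneg_left ?_ hκ) hκD
    linarith only [norm_sub_le x y, hlocp.1, hlocp.2.1]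
  obtain ⟨hn1, hn2⟩ := norm_concaveConeGrad_mem hL.le hκ hnep hκn
  refine ⟨ξ, hξΩ, η, hηΩ, g₁ x, g₂ y, e, fderiv ℝ g₁ x, fderiv ℝ g₂ y,
    ⟨symm_of_hasFDerivAt_gradient hv₁ hd₁x.hasFDerivAt,
      symm_of_hasFDerivAt_gradient hv₂ hd₂y.hasFDerivAt⟩,
    ⟨norm_fderiv_le_of_lipschitz ℝ hlip₁, norm_fderiv_le_of_lipschitz ℝ hlip₂⟩,
    ⟨isSuperjet_of_contact (mem_of_superset (hΩ.mem_nhds hξΩ) hΩK) hb₁ hξe ht₁,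
      isSuperjet_of_contact (mem_of_superset (hΩ.mem_nhds hηΩ) hΩK) hb₂ hηe ht₂⟩,
    ⟨?_, ?_, ?_, ?_, ?_⟩, hle, he1, he2⟩
  · rw [hgx, hgy, show ∀ G : E, G + p.1 + (-G + p.2) = p.1 + p.2 from fun G => by abel]
    linarith only [norm_add_le p.1 p.2, hp.1, hp.2, hr2]
  · rw [hgx]
    have := norm_sub_le_norm_add (concaveConeGrad L κ (x - y)) p.1
    linarith only [this, hn1, hp.1, hr, hr2]
  · rw [hgx]
    linarith only [norm_add_le (concaveConeGrad L κ (x - y)) p.1, hn2, hp.1, hr, hr2]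
  · rw [hgy]
    have := norm_sub_le_norm_add (-concaveConeGrad L κ (x - y)) p.2
    rw [norm_neg] at this
    linarith only [this, hn1, hn2, hp.2, hr, hr2]
  · rw [hgy]
    have := norm_add_le (-concaveConeGrad L κ (x - y)) p.2
    rw [norm_neg] at this
    linarith only [this, hn1, hn2, hp.2, hr, hr2]

end doubling

/-! ### Uniform continuity of F and the interior contradiction -/

theorem continuous_quadMatrix {n : ℕ} :
    Continuous (quadMatrix : (EucSp n →L[ℝ] EucSp n) → Matrix (Fin n) (Fin n) ℝ) := by
  refine continuous_matrix fun i j => ?_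
  simp only [quadMatrix, Matrix.of_apply]
  fun_prop

/-- Gradients bounded away from 0 and bounded symmetric T form a compact set, where F is uniformly
continuous. This absorbs the small mismatch between the two gradients. -/
theorem ContinuousOffZero.exists_abs_sub_lt {n : ℕ} {F : SecondOrderOp n} (hF : ContinuousOffZero F)
    {r₁ : ℝ} (hr₁ : 0 < r₁) (r₂ N : ℝ) :
    ∃ δ > 0, ∀ (p q : EucSp n) (T : EucSp n →L[ℝ] EucSp n), r₁ ≤ ‖p‖ → ‖p‖ ≤ r₂ → r₁ ≤ ‖q‖ →
      ‖q‖ ≤ r₂ → ‖T‖ ≤ N → (∀ a b, ⟪T a, b⟫ = ⟪a, T b⟫) → ‖p - q‖ < δ →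
      |F p (quadMatrix T) - F q (quadMatrix T)| < 1 := by
  have : ProperSpace (EucSp n →L[ℝ] EucSp n) := FiniteDimensional.proper ℝ _
  set S : Set (EucSp n × (EucSp n →L[ℝ] EucSp n)) :=
    {w | (r₁ ≤ ‖w.1‖ ∧ ‖w.1‖ ≤ r₂) ∧ ‖w.2‖ ≤ N ∧ ∀ a b, ⟪w.2 a, b⟫ = ⟪a, w.2 b⟫} with hS
  have hclosed : IsClosed S := by
    refine ((isClosed_le continuous_const continuous_fst.norm).inter
      (isClosed_le continuous_fst.norm continuous_const)).inter
      ((isClosed_le continuous_snd.norm continuous_const).inter ?_)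
    have : {w : EucSp n × (EucSp n →L[ℝ] EucSp n) | ∀ a b, ⟪w.2 a, b⟫ = ⟪a, w.2 b⟫} =
        ⋂ (a) (b), {w | ⟪w.2 a, b⟫ = ⟪a, w.2 b⟫} := by ext; simp
    have hcl : IsClosed {w : EucSp n × (EucSp n →L[ℝ] EucSp n) |
        ∀ a b, ⟪w.2 a, b⟫ = ⟪a, w.2 b⟫} := by
      rw [this]
      exact isClosed_iInter fun a => isClosed_iInter fun b =>
        isClosed_eq (by fun_prop) (by fun_prop)
    exact hcl
  have hcomp : IsCompact S := by
    refine Metric.isCompact_of_isClosed_isBounded hclosed ?_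
    refine ((Metric.isBounded_closedBall (x := (0 : EucSp n)) (r := r₂)).prod
      (Metric.isBounded_closedBall (x := (0 : EucSp n →L[ℝ] EucSp n)) (r := N))).subset ?_
    exact fun w hw => ⟨mem_closedBall_zero_iff.2 hw.1.2, mem_closedBall_zero_iff.2 hw.2.1⟩
  have hcont : ContinuousOn (fun w : EucSp n × (EucSp n →L[ℝ] EucSp n) =>
      F w.1 (quadMatrix w.2)) S := by
    refine hF.comp (continuous_fst.prodMk
      (continuous_quadMatrix.comp continuous_snd)).continuousOn fun w hw => ?_
    exact ⟨norm_pos_iff.1 (hr₁.trans_le hw.1.1), quadMatrix_isSymm hw.2.2⟩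
  obtain ⟨δ, hδ, h⟩ := Metric.uniformContinuousOn_iff.1
    (hcomp.uniformContinuousOn_of_continuous hcont) 1 one_pos
  refine ⟨δ, hδ, fun p q T h1 h2 h3 h4 h5 h6 h7 => ?_⟩
  have := h (p, T) ⟨⟨h1, h2⟩, h5, h6⟩ (q, T) ⟨⟨h3, h4⟩, h5, h6⟩
    (by rwa [Prod.dist_eq, dist_self, max_eq_left dist_nonneg, dist_eq_norm])
  rwa [Real.dist_eq] at this

section main
variable {n : ℕ} {α a A : ℝ} {F : SecondOrderOp n} {Ω : Set (EucSp n)} {f u : EucSp n → ℝ}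

/-- For steep cones, `u x - u y - ψ (x - y)` has no positive interior maximum. -/
theorem sub_le_concaveCone (hα : -1 < α) (ha : 0 < a)
    (hF : ContinuousOffZero F) (hF₂ : WeightedUniformlyElliptic α a A F)
    (hΩ : IsOpen Ω) (hcomp : IsCompact (closure Ω)) {C : ℝ} (hC : ∀ x ∈ Ω, |f x| ≤ C)
    (hu : ContinuousOn u (closure Ω)) (hs : IsViscositySol F Ω (fun x _ => f x) u)
    {L κ D : ℝ} (hL : 0 < L) (hκ : 0 < κ) (hD : ∀ x ∈ closure Ω, ‖x‖ ≤ D)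
    (hκD : κ * (2 * (D + 1)) ≤ 1 / 4)
    (hLC : 2 * C + 1 ≤ 4 * a * κ * (L / 4) ^ (1 + α))
    (hint : ∀ x ∈ closure Ω, ∀ y ∈ closure Ω, 0 < u x - u y - concaveCone L κ (x - y) →
      x ∈ Ω ∧ y ∈ Ω) :
    ∀ x ∈ closure Ω, ∀ y ∈ closure Ω, u x - u y ≤ concaveCone L κ (x - y) := by
  by_contra! hcon
  obtain ⟨x, hx, y, hy, hxy⟩ := hcon
  obtain ⟨N, hN⟩ := exists_superjets_of_doubling hcomp hΩ subset_closure hu hL hκ.le hD hκD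
    ⟨x, hx, y, hy, by linarith⟩ hint
  obtain ⟨δ, hδ, hFδ⟩ := hF.exists_abs_sub_lt (r₁ := L / 4) (by positivity) (2 * L) N
  -- The part `δ / 2` makes p and -q close enough for the continuity of F; `L / 4` keeps both norms
  -- between `L / 4` and `2 L`.
  obtain ⟨ξ, hξ, η, hη, p, q, e, T₁, T₂, ⟨hT₁, hT₂⟩, ⟨hN₁, -⟩, ⟨hj₁, hj₂⟩,
    ⟨hpq, hp1, hp2, hq1, hq2⟩, hle, he, hneg⟩ := hN (min (δ / 2) (L / 4)) (by positivity)
  have hθ1 := min_le_left (δ / 2) (L / 4)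
  have hθ2 := min_le_right (δ / 2) (L / 4)
  have hp0 : p ≠ 0 := norm_pos_iff.1 (by linarith)
  have hq0 : 0 < ‖q‖ := by linarith
  have hnq0 : -q ≠ 0 := neg_ne_zero.2 (norm_pos_iff.1 hq0)
  have hsub := hs.1.le_of_isSuperjet hΩ hF₂ hu hξ hp0 hT₁ hj₁
  have hsuper := hs.2.le_of_isSuperjet_neg (p := -q) (T := -T₂) hΩ hF₂ hu hη hnq0
    (fun a b => by simp [hT₂]) (by simpa using hj₂)
  have hclose := hFδ p (-q) T₁ (by linarith) (by linarith) (by rw [norm_neg]; linarith)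
    (by rw [norm_neg]; linarith) hN₁ hT₁ (by rw [sub_neg_eq_add]; linarith)
  -- Passing from `T₁` to `-T₂` adds the nonnegative form `-(T₁ + T₂)`, which is at least `8 L κ`
  -- along e.
  have hell := hF₂.add_inner_le ha.le hnq0 he (quadMatrix_isSymm hT₁) (P := -(T₁ + T₂))
    (fun a b => by simp [inner_add_left, inner_add_right, hT₁, hT₂])
    (fun k => by rw [neg_apply, inner_neg_left]; linarith [hle k])
  rw [← quadMatrix_add, show T₁ + -(T₁ + T₂) = -T₂ by abel, neg_apply, inner_neg_left,
    norm_neg] at hell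
  have hqα : 0 ≤ ‖q‖ ^ α := Real.rpow_nonneg (norm_nonneg q) α
  have h1 : a * ‖q‖ ^ α * (8 * L * κ) ≤ a * ‖q‖ ^ α * -⟪(T₁ + T₂) e, e⟫ := by
    gcongr; linarith
  have h2 : (L / 4) ^ (1 + α) ≤ 2 * L * ‖q‖ ^ α := by
    calc (L / 4) ^ (1 + α) ≤ ‖q‖ ^ (1 + α) :=
          Real.rpow_le_rpow (by positivity) (by linarith) (by linarith)
      _ = ‖q‖ * ‖q‖ ^ α := by rw [Real.rpow_add hq0, Real.rpow_one]
      _ ≤ 2 * L * ‖q‖ ^ α := by gcongr; linarith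
  have h3 := mul_le_mul_of_nonneg_left h2 (by positivity : 0 ≤ 4 * a * κ)
  have h4 := (abs_le.1 (hC ξ hξ)).1
  have h5 := (abs_le.1 (hC η hη)).2
  have h6 := (abs_lt.1 hclose).2
  linarith

end main

/-! ### Choice of constants and conclusion -/

theorem mainTheorem7 (n : ℕ) (α a A : ℝ) (hα : -1 < α) (ha : 0 < a) (haA : a ≤ A)
    (F : SecondOrderOp n) (hF : ContinuousOffZero F)
    (hF₁ : HomogeneousElliptic α F) (hF₂ : WeightedUniformlyElliptic α a A F)
    (Ω : Set (EucSp n)) (hΩ : IsBoundedC2Domain Ω)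
    (f : EucSp n → ℝ) (hf : ∃ C : ℝ, ∀ x ∈ Ω, |f x| ≤ C)
    (u : EucSp n → ℝ) (hu_cont : ContinuousOn u (closure Ω))
    (hu_nonneg : ∀ x ∈ closure Ω, 0 ≤ u x)
    (hu_sol : IsViscositySol F Ω (fun x _ => f x) u)
    (hu_bdry : ∀ x ∈ frontier Ω, u x = 0) :
    LocallyLipschitzOn Ω u := by
  obtain ⟨L₀, hL₀, hlin⟩ :=
    boundary_linear_bound hα ha haA hF₁ hF₂ hΩ hf hu_cont hu_sol.1 hu_bdry
  obtain ⟨C, hC⟩ := hf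
  obtain ⟨D₀, hD₀⟩ := hΩ.2.1.closure.exists_norm_le
  obtain ⟨D, hD0, hD⟩ : ∃ D : ℝ, 0 ≤ D ∧ ∀ x ∈ closure Ω, ‖x‖ ≤ D :=
    ⟨|D₀|, abs_nonneg _, fun x hx => (hD₀ x hx).trans (le_abs_self _)⟩
  have hcomp : IsCompact (closure Ω) :=
    Metric.isCompact_of_isClosed_isBounded isClosed_closure hΩ.2.1.closure
  -- The radius `D + 1` leaves room for the maximum points of the regularized problem, which may
  -- leave `closure Ω`.
  obtain ⟨κ, hκ, hκD⟩ : ∃ κ : ℝ, 0 < κ ∧ κ * (2 * (D + 1)) ≤ 1 / 4 :=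
    ⟨1 / (8 * (D + 1)), by positivity, by
      rw [div_mul_eq_mul_div, div_le_iff₀ (by positivity)]; linarith⟩
  obtain ⟨L, hL, hL1, hLC⟩ : ∃ L : ℝ, 0 < L ∧ 2 * L₀ ≤ L ∧
      2 * C + 1 ≤ 4 * a * κ * (L / 4) ^ (1 + α) := by
    have t : Tendsto (fun L : ℝ => 4 * a * κ * (L / 4) ^ (1 + α)) atTop atTop :=
      Tendsto.const_mul_atTop (by positivity) <|
        (tendsto_rpow_atTop (by linarith)).comp (tendsto_id.atTop_div_const (by norm_num))
    obtain ⟨L, h1, h2, h3⟩ := ((eventually_gt_atTop (0 : ℝ)).and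
      ((eventually_ge_atTop (2 * L₀)).and (t.eventually_ge_atTop (2 * C + 1)))).exists
    exact ⟨L, h1, h2, h3⟩
  have hκn : ∀ x ∈ closure Ω, ∀ y ∈ closure Ω, κ * ‖x - y‖ ≤ 1 / 4 := fun x hx y hy => by
    refine le_trans (mul_le_mul_of_nonneg_left ?_ hκ.le) hκD
    linarith [norm_sub_le x y, hD x hx, hD y hy]
  have hmem : ∀ x ∈ closure Ω, x ∉ Ω → x ∈ frontier Ω := fun x hx hn =>
    ⟨hx, by rwa [hΩ.1.interior_eq]⟩
  have hint : ∀ x ∈ closure Ω, ∀ y ∈ closure Ω, 0 < u x - u y - concaveCone L κ (x - y) →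
      x ∈ Ω ∧ y ∈ Ω := by
    intro x hx y hy hpos
    have h0 := concaveCone_nonneg hL.le (hκn x hx y hy)
    constructor
    · by_contra hn
      linarith [hu_bdry x (hmem x hx hn), hu_nonneg y hy]
    · by_contra hn
      have h1 := hlin y (hmem y hy hn) x hx
      -- On the relevant range the modulus is at least half its linear part, so `L ≥ 2 L₀` puts it
      -- above the boundary growth.
      have h2 : L * (1 / 2 * ‖x - y‖) ≤ concaveCone L κ (x - y) := by
        refine mul_le_mul_of_nonneg_left ?_ hL.le
        nlinarith [hκn x hx y hy, norm_nonneg (x - y)]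
      have h3 := mul_le_mul_of_nonneg_right hL1 (norm_nonneg (x - y))
      linarith [hu_bdry y (hmem y hy hn)]
  have hmain := sub_le_concaveCone hα ha hF hF₂ hΩ.1 hcomp hC hu_cont hu_sol hL hκ hD hκD hLC hint
  have hlip : LipschitzOnWith (Real.toNNReal L) u Ω := by
    refine LipschitzOnWith.of_le_add_mul' L fun x hx y hy => ?_
    have h1 := hmain x (subset_closure hx) y (subset_closure hy)
    have h2 : concaveCone L κ (x - y) ≤ L * dist x y := by
      rw [dist_eq_norm]
      refine mul_le_mul_of_nonneg_left ?_ hL.le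
      linarith [mul_nonneg hκ.le (sq_nonneg ‖x - y‖)]
    linarith
  exact fun x _ => ⟨_, Ω, self_mem_nhdsWithin, hlip⟩
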